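/- Let $K$ be a non-Archimedean local field with canonical absolute value $|\cdot|$ (the factor by which multiplication scales additive Haar measure), ring of integers $O$, maximal ideal $P=\beta O$ with uniformizer $\beta$, and residue field $O/P$ with $q$ elements. For $r\in\mathbf Z$ put $B_r=\beta^{-r}O$. Let $S\ni 0$ be a complete set of representatives of $O/P$ in $O$, and let $\chi$ be a continuous unitary character of $(K,+)$ of rank zero, i.e. $0$ is the largest integer $r$ with $\chi|_{B_r}\equiv 1$. Let $\alpha>0$, $t>0$, let $n\ge 1$ be an integer, and let $v:K\to[0,\infty)$ be continuous with $v(x)\to\infty$ as $|x|\to\infty$. Let $X_n=\{\sum_{i=-n}^{n-1}a_i\beta^i : a_i\in S\}$, the canonical set of representatives of $B_n/B_{-n}$, with the group structure of $B_n/B_{-n}$ and the Haar measure $\mu_n$ giving mass $q^{-n}$ to each point. On $L^2(X_n)=L^2(X_n,\mu_n)$ let $$(\mathcal F_nf)(x)=q^{-n}\sum_{y\in X_n}f(y)\chi(-xy),\qquad (\mathcal F_n^{-1}f)(x)=q^{-n}\sum_{y\in X_n}f(y)\chi(xy),$$ $(Q_nf)(x)=|x|f(x)$, $P_n=\mathcal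 F_n^{-1}Q_n\mathcal F_n$ (a positive operator), $(V_nf)(x)=v_n(x)f(x)$ with $v_n=v|_{X_n}$, and $H_n=P_n^\alpha+V_n$. For $s\ge 0$ put $p_{s,n}=\mathcal F_n^{-1}(e^{-s|\cdot|^\alpha})$, that is, $p_{s,n}(x)=q^{-n}\sum_{\xi\in X_n}e^{-s|\xi|^\alpha}\chi(x\xi)$, $x\in X_n$. Let $D[0,t]$ be the space of functions $\omega:[0,t]\to K$ which are right continuous on $[0,t)$, have left limits on $(0,t]$, and are left continuous at $t$, with the $\sigma$-algebra generated by the evaluations $\omega\mapsto\omega(s)$. Then for each $a\in X_n$ there is a unique probability measure $\mathbf P^n_a$ on $D[0,t]$ such that $$\mathbf P^n_a(\omega(t_i)\in J_i,\ 1\le i\le N)=\sum_{b_i\in J_i\cap X_n,\ 1\le i\le N}p_{t_1,n}(b_1-a)\,p_{t_2-t_1,n}(b_2-b_1)\cdots p_{t_N-t_{N-1},n}(b_N-b_{N-1})\,q^{-nN}$$ for all $0\le t_1<\dots<t_N\le t$ and all Borel sets $J_1,\dots,J_N\subset K$. For $a,b\in X_n$ let $\mathbf P^n_{a,b,t}(A)=\mathbf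 P^n_a(A\cap(\omega(t)=b))/\mathbf P^n_a(\omega(t)=b)$. Then $e^{-tH_n}$ is an integral operator: for all $f\in L^2(X_n)$ and $x\in X_n$, $$(e^{-tH_n}f)(x)=\int_{X_n}K^n_t(x,y)f(y)\,d\mu_n(y)=q^{-n}\sum_{y\in X_n}K^n_t(x,y)f(y),$$ where $$K^n_t(x,y)=\int_{D[0,t]}\exp\Big(-\int_0^tv_n(\omega(s))\,ds\Big)\,d\mathbf P^n_{x,y,t}(\omega)\cdot p_{t,n}(y-x),\qquad x,y\in X_n.$$ Here, off $X_n$, $v_n$ is read as $\sum_{y\in X_n}v(y)\mathbf 1_{y+B_{-n}}$. -/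

import Mathlib

open MeasureTheory ValuativeRel Filter Topology

noncomputable section

namespace FiniteFK

section LocalField

variable {K : Type*} [Field K] [ValuativeRel K] [TopologicalSpace K]
  [IsNonarchimedeanLocalField K]

/-- The canonical absolute value of a local field, induced by the Haar measure: `|0| = 0` and, for
`x ≠ 0`, `|x|` is the factor by which multiplication by `x` scales every additive Haar measure. -/
def canonicalAbs (x : K) : ℝ :=
  open Classical in
  if hx : x = 0 then 0 else (distribHaarChar K (Units.mk0 x hx) : ℝ)

variable (K) in
/-- The number `q` of elements of the residue field `O / P`. -/
def residueCard : ℕ := Nat.card (IsLocalRing.ResidueField (valuation K).integer)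

/-- `β` is a uniformizer: `P = β O`, where `O = {x | v x ≤ 1}` and `P = {x | v x < 1}`. -/
def IsUniformizer (β : K) : Prop :=
  ∀ x : K, valuation K x < 1 ↔ ∃ y : K, valuation K y ≤ 1 ∧ x = β * y

/-- The ball `B_r = β ^ (-r) O` of radius `q ^ r`, for an integer `r`. -/
def ball (β : K) (r : ℤ) : Set K := {x | valuation K (β ^ r * x) ≤ 1}

/-- The character `χ` has rank zero: the largest integer `r` with `χ = 1` on `B_r` is `0`. -/
def HasRankZero (β : K) (χ : AddChar K Circle) : Prop :=
  IsGreatest {r : ℤ | ∀ x ∈ ball β r, χ x = 1} 0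

/-- `S` is a complete set of representatives of the residue classes in `O / P`, in which the zero
class is represented by `0`. -/
structure IsResidueSystem (S : Finset K) : Prop where
  subset_integers : ∀ s ∈ S, valuation K s ≤ 1
  existsUnique_rep : ∀ x : K, valuation K x ≤ 1 → ∃! s, s ∈ S ∧ valuation K (x - s) < 1
  zero_mem : (0 : K) ∈ S

/-- The canonical set `X_n` of representatives of `G_n = B_n / B_{-n}`: all the sums
`a_{-n} β ^ (-n) + ⋯ + a_{n-1} β ^ (n-1)` with digits in `S`. -/
def grid (β : K) (S : Finset K) (n : ℕ) : Finset K :=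
  open Classical in
  (Fintype.piFinset fun _ : Fin (2 * n) => S).image
    fun a => ∑ i : Fin (2 * n), a i * β ^ ((i : ℤ) - (n : ℤ))

/-- The Hilbert space `L²(X_n)` of all complex functions on `X_n`. All the points of `X_n` have the
same mass `q ^ (-n)`, so leaving this factor out of the inner product changes neither adjoints nor
positivity of operators, nor their functions. -/
abbrev GridL2 (β : K) (S : Finset K) (n : ℕ) : Type _ := EuclideanSpace ℂ (grid β S n)

/-- The operator on `L²(X_n)` given by a matrix: `(A f)(x) = ∑ y, A x y * f y`. -/
def matrixOp (β : K) (S : Finset K) (n : ℕ) (A : Matrix (grid β S n) (grid β S n) ℂ) :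
    GridL2 β S n →L[ℂ] GridL2 β S n :=
  open Classical in Matrix.toEuclideanCLM (n := grid β S n) (𝕜 := ℂ) A

/-- Multiplication by (the restriction to `X_n` of) a real function on `K`. -/
def mulOp (β : K) (S : Finset K) (n : ℕ) (g : K → ℝ) : GridL2 β S n →L[ℂ] GridL2 β S n :=
  open Classical in matrixOp β S n (Matrix.diagonal fun x => ((g x : ℝ) : ℂ))

/-- The finite Fourier transform, `(F_n f)(x) = q ^ (-n) ∑ y, f y * χ (-x y)`. -/
def fourierOp (β : K) (S : Finset K) (n : ℕ) (χ : AddChar K Circle) :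
    GridL2 β S n →L[ℂ] GridL2 β S n :=
  matrixOp β S n (Matrix.of fun x y =>
    ((residueCard K : ℂ) ^ n)⁻¹ * (χ (-((x : K) * (y : K))) : ℂ))

/-- The inverse finite Fourier transform, `(F_n⁻¹ f)(x) = q ^ (-n) ∑ y, f y * χ (x y)`. -/
def fourierInvOp (β : K) (S : Finset K) (n : ℕ) (χ : AddChar K Circle) :
    GridL2 β S n →L[ℂ] GridL2 β S n :=
  matrixOp β S n (Matrix.of fun x y =>
    ((residueCard K : ℂ) ^ n)⁻¹ * (χ ((x : K) * (y : K)) : ℂ))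

/-- The finite momentum operator `P_n = F_n⁻¹ Q_n F_n`, where `(Q_n f)(x) = |x| f(x)`. -/
def momentumOp (β : K) (S : Finset K) (n : ℕ) (χ : AddChar K Circle) :
    GridL2 β S n →L[ℂ] GridL2 β S n :=
  fourierInvOp β S n χ * mulOp β S n canonicalAbs * fourierOp β S n χ

/-- The finite Hamiltonian `H_n = P_n ^ α + V_n`; the power of the positive operator `P_n` is the
one of the continuous functional calculus. -/
def hamiltonian (β : K) (S : Finset K) (n : ℕ) (χ : AddChar K Circle) (α : ℝ) (v : K → ℝ) :
    GridL2 β S n →L[ℂ] GridL2 β S n :=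
  momentumOp β S n χ ^ α + mulOp β S n v

/-- The density `p_{s,n}(x) = (F_n⁻¹ e^{-s|·|^α})(x) = q ^ (-n) ∑ ξ, e^{-s|ξ|^α} χ (x ξ)`, the sum
being over `ξ ∈ X_n`. The formula makes sense for every `x ∈ K` and depends only on the class of
`x` modulo `B_{-n}` (see `density_add`); hence `density (y - x)`, with the difference taken in `K`,
is the value of `p_{s,n}` at the difference of `x, y ∈ X_n` in the group `X_n ≃ B_n / B_{-n}`. -/
def density (β : K) (S : Finset K) (n : ℕ) (χ : AddChar K Circle) (α s : ℝ) (x : K) : ℂ :=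
  ((residueCard K : ℂ) ^ n)⁻¹ *
    ∑ ξ ∈ grid β S n, (Real.exp (-s * canonicalAbs ξ ^ α) : ℂ) * (χ (x * ξ) : ℂ)

/-- The finite version of a function on `K`: `E_n g = ∑ y, g y * 1_{y + B_{-n}}`, over `y ∈ X_n`. -/
def discretize (β : K) (S : Finset K) (n : ℕ) (g : K → ℝ) (z : K) : ℝ :=
  ∑ y ∈ grid β S n, {w : K | w - y ∈ ball β (-(n : ℤ))}.indicator (fun _ => g y) z

theorem density_add (β : K) (hβ : IsUniformizer β) (S : Finset K) (hS : IsResidueSystem S)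
    (n : ℕ) (χ : AddChar K Circle) (hχ : HasRankZero β χ) (α s : ℝ) (x h : K)
    (hh : h ∈ ball β (-(n : ℤ))) :
    density β S n χ α s (x + h) = density β S n χ α s x := by
  classical
  have hβ1 : valuation K β ≤ 1 := ((hβ β).2 ⟨1, by simp, by simp⟩).le
  have hβ0 : β ≠ 0 := by
    rintro rfl
    obtain ⟨r, hr, hr'⟩ := Valuation.IsNontrivial.exists_lt_one (v := valuation K)
    obtain ⟨y, -, hy⟩ := (hβ r).1 hr'
    exact hr (by simp [hy])
  unfold density
  congr 1
  refine Finset.sum_congr rfl fun ξ hξ => ?_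
  obtain ⟨a, ha, rfl⟩ := Finset.mem_image.1 hξ
  have ha' := Fintype.mem_piFinset.1 ha
  congr 2
  rw [add_mul, AddChar.map_add_eq_mul]
  have : χ (h * ∑ i : Fin (2 * n), a i * β ^ ((i : ℤ) - (n : ℤ))) = 1 := by
    apply hχ.1
    have e : β ^ (0 : ℤ) * (h * ∑ i : Fin (2 * n), a i * β ^ ((i : ℤ) - (n : ℤ)))
        = (β ^ (-(n : ℤ)) * h) * ∑ i : Fin (2 * n), a i * β ^ (i : ℕ) := by
      simp only [zpow_zero, one_mul, Finset.mul_sum]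
      refine Finset.sum_congr rfl fun i _ => ?_
      rw [sub_eq_add_neg, zpow_add₀ hβ0, zpow_natCast]
      ring
    change valuation K _ ≤ 1
    rw [e, map_mul]
    refine mul_le_one' hh ?_
    refine Valuation.map_sum_le _ fun i _ => ?_
    rw [map_mul, map_pow]
    exact mul_le_one' (hS.subset_integers _ (ha' i)) (pow_le_one' hβ1 _)
  rw [this, mul_one]

end LocalField

section Paths

/-- The space `D[0,t]`: functions on `[0,t]` that are right continuous on `[0,t)`, have left limits
on `(0,t]`, and are left continuous at `t`. As a set of functions it carries the σ-algebra generated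
by the evaluations `ω ↦ ω s`, `s ∈ [0,t]`. -/
def skorokhod (K : Type*) [TopologicalSpace K] (t : ℝ) : Set (Set.Icc (0 : ℝ) t → K) :=
  {ω | (∀ s : Set.Icc (0 : ℝ) t, (s : ℝ) < t → Tendsto ω (𝓝[>] s) (𝓝 (ω s))) ∧
    (∀ s : Set.Icc (0 : ℝ) t, 0 < (s : ℝ) → ∃ l : K, Tendsto ω (𝓝[<] s) (𝓝 l)) ∧
    (∀ s : Set.Icc (0 : ℝ) t, (s : ℝ) = t → Tendsto ω (𝓝[<] s) (𝓝 (ω s)))}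

variable {K : Type*} [Field K] [ValuativeRel K] [TopologicalSpace K]
  [IsNonarchimedeanLocalField K] [MeasurableSpace K]

/-- `P` is a probability measure on `D[0,t]` with the finite dimensional distributions
`P (ω t_1 ∈ J_1, …, ω t_N ∈ J_N) =
  ∑ p_{t_1,n}(b_1 - a) p_{t_2-t_1,n}(b_2 - b_1) ⋯ p_{t_N-t_{N-1},n}(b_N - b_{N-1}) q ^ (-nN)`,
the sum being over all `b_i ∈ J_i ∩ X_n`. -/
structure IsPathLaw (β : K) (S : Finset K) (n : ℕ) (χ : AddChar K Circle) (α t : ℝ) (a : K)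
    (P : Measure (skorokhod K t)) : Prop where
  isProbabilityMeasure : IsProbabilityMeasure P
  cylinder : ∀ (N : ℕ) (τ : Fin N → Set.Icc (0 : ℝ) t), StrictMono τ →
    ∀ J : Fin N → Set K, (∀ i, MeasurableSet (J i)) →
      ((P.real {ω | ∀ i, ω.1 (τ i) ∈ J i} : ℝ) : ℂ) =
        open Classical in
        ∑ b ∈ Fintype.piFinset (fun i => (grid β S n).filter (· ∈ J i)),
          (∏ i : Fin N, density β S n χ α
            ((τ i : ℝ) - (Fin.cons 0 (fun j => (τ j : ℝ)) : Fin (N + 1) → ℝ) i.castSucc)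
            (b i - (Fin.cons a b : Fin (N + 1) → K) i.castSucc)) *
          ((residueCard K : ℂ) ^ (n * N))⁻¹

/-- The measure `P^n_a` on `D[0,t]` (with value `0` if there were no measure as required). -/
def pathMeasure (β : K) (S : Finset K) (n : ℕ) (χ : AddChar K Circle) (α t : ℝ) (a : K) :
    Measure (skorokhod K t) :=
  open Classical in
  if h : ∃ P : Measure (skorokhod K t), IsPathLaw β S n χ α t a P then h.choose else 0

/-- The conditioned measure `P^n_{a,b,t}(A) = P^n_a(A ∩ (ω t = b)) / P^n_a(ω t = b)`. -/
def bridgeMeasure (β : K) (S : Finset K) (n : ℕ) (χ : AddChar K Circle) (α t : ℝ) (a b : K) :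
    Measure (skorokhod K t) :=
  ProbabilityTheory.cond (pathMeasure β S n χ α t a)
    {ω | ∀ s : Set.Icc (0 : ℝ) t, (s : ℝ) = t → ω.1 s = b}

/-- The kernel `K^n_t(x,y) = ∫ exp (-∫₀ᵗ v_n(ω s) ds) dP^n_{x,y,t}(ω) · p_{t,n}(y - x)`. -/
def kernel (β : K) (S : Finset K) (n : ℕ) (χ : AddChar K Circle) (α t : ℝ) (v : K → ℝ)
    (x y : K) : ℂ :=
  ((∫ ω, Real.exp (-∫ s : Set.Icc (0 : ℝ) t, discretize β S n v (ω.1 s) ∂(volume.comap Subtype.val))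
      ∂(bridgeMeasure β S n χ α t x y) : ℝ) : ℂ) * density β S n χ α t (y - x)

/-- The Haar measure `μ_n` on `X_n`, each point having mass `q ^ (-n)`. -/
def gridMeasure (β : K) (S : Finset K) (n : ℕ) : Measure (grid β S n) :=
  ((residueCard K : ENNReal) ^ n)⁻¹ • Measure.count

end Paths

end FiniteFK

end

/-!
On the finite group `B_n / B_{-n}` the function `|·| ^ α` is conditionally negative definite,
because its sublevel sets are subgroups and the Fourier transform of the indicator of a subgroup is
nonnegative. Hence `-|·| ^ α` is the exponent of a compound Poisson process on `X_n`
(Lévy–Khintchine), whose paths are step functions in `D[0,t]`, and this process has the law `P^n_a`.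

The operator `exp (-s P_n ^ α)` has the kernel `p_{s,n}`, so the Trotter products
`(exp (-(t/m) P_n ^ α) exp (-(t/m) V_n)) ^ m` are sums over paths, that is, integrals of
`exp (-(t/m) ∑ i ∈ {1, …, m}, v_n (ω (i t / m)))` against `P^n_x` on the event `ω t = y`. As `m → ∞`
the products tend to `exp (-t H_n)`. The exponents are Riemann sums of `s ↦ v_n (ω s)`, which is
right continuous, so by dominated convergence the integrals tend to that of the Feynman–Kac weight.
Dividing by the probability of the event, which is `p_{t,n} (y - x) q ^ (-n)`, gives the conditioned
measure.
-/

noncomputable section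

namespace FiniteFK

/-! ### Balls and grids -/

section Balls

variable {K : Type*} [Field K] [ValuativeRel K] {β x y : K} {r s : ℤ}

/-- The ball `B_r` as an additive subgroup of `K`. -/
def ballSubgroup (β : K) (r : ℤ) : AddSubgroup K :=
  (valuation K).integer.toAddSubgroup.comap (AddMonoidHom.mulLeft (β ^ r))

theorem mem_ballSubgroup : x ∈ ballSubgroup β r ↔ valuation K (β ^ r * x) ≤ 1 :=
  Iff.rfl

theorem zpow_mul_mem_ballSubgroup (hβ : β ≠ 0) (s : ℤ) :
    β ^ s * x ∈ ballSubgroup β r ↔ x ∈ ballSubgroup β (r + s) := by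
  rw [mem_ballSubgroup, mem_ballSubgroup, zpow_add₀ hβ, mul_assoc]

theorem mul_left_mem_ballSubgroup (hβ : β ≠ 0) :
    β * x ∈ ballSubgroup β r ↔ x ∈ ballSubgroup β (r + 1) := by
  simpa using zpow_mul_mem_ballSubgroup (x := x) (r := r) hβ 1

theorem mul_mem_ballSubgroup (hβ : β ≠ 0) (hx : x ∈ ballSubgroup β r)
    (hy : y ∈ ballSubgroup β s) : x * y ∈ ballSubgroup β (r + s) := by
  rw [mem_ballSubgroup, zpow_add₀ hβ, mul_mul_mul_comm, map_mul]
  exact mul_le_one' hx hy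

theorem IsUniformizer.valuation_lt_one (hβ : IsUniformizer β) : valuation K β < 1 :=
  (hβ β).2 ⟨1, by simp, by simp⟩

variable [ValuativeRel.IsNontrivial K]

theorem IsUniformizer.ne_zero (hβ : IsUniformizer β) : β ≠ 0 := by
  rintro rfl
  obtain ⟨r, hr, hr'⟩ := Valuation.IsNontrivial.exists_lt_one (v := valuation K)
  obtain ⟨y, -, hy⟩ := (hβ r).1 hr'
  exact hr (by simp [hy])

theorem IsUniformizer.valuation_lt_one_iff (hβ : IsUniformizer β) :
    valuation K x < 1 ↔ x ∈ ballSubgroup β (-1) := by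
  rw [hβ, mem_ballSubgroup, zpow_neg_one]
  constructor
  · rintro ⟨y, hy, rfl⟩
    rwa [inv_mul_cancel_left₀ hβ.ne_zero]
  · exact fun hx => ⟨β⁻¹ * x, hx, (mul_inv_cancel_left₀ hβ.ne_zero x).symm⟩

theorem ballSubgroup_mono (hβ : IsUniformizer β) (h : r ≤ s) :
    ballSubgroup β r ≤ ballSubgroup β s := by
  intro x hx
  obtain ⟨k, rfl⟩ := Int.le.dest h
  rw [mem_ballSubgroup, add_comm, zpow_add₀ hβ.ne_zero, zpow_natCast, mul_assoc, map_mul, map_pow]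
  exact mul_le_one' (pow_le_one' hβ.valuation_lt_one.le _) hx

theorem inv_mem_ballSubgroup_of_notMem (hβ : IsUniformizer β)
    (hx : x ∉ ballSubgroup β r) : x⁻¹ ∈ ballSubgroup β (-r - 1) := by
  have h_inv : valuation K (β ^ r * x)⁻¹ < 1 := by
    rw [map_inv₀]
    exact inv_lt_one_of_one_lt₀ (not_le.1 hx)
  rwa [mul_inv, ← zpow_neg, hβ.valuation_lt_one_iff, zpow_mul_mem_ballSubgroup hβ.ne_zero,
    add_comm, ← sub_eq_add_neg] at h_inv

end Balls

section Digits

variable {K : Type*} [Field K] {β x : K} {S : Finset K} {m : ℕ}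

theorem sum_digits_succ (β : K) (a : Fin (m + 1) → K) :
    ∑ i, a i * β ^ (i : ℕ) = a 0 + β * ∑ i, Fin.tail a i * β ^ (i : ℕ) := by
  rw [Fin.sum_univ_succ, Finset.mul_sum]
  simp only [Fin.tail, Fin.val_zero, Fin.val_succ, pow_zero, mul_one, pow_succ']
  exact congrArg _ (Finset.sum_congr rfl fun i _ => mul_left_comm _ _ _)

variable [ValuativeRel K]

theorem sum_digits_mem_ballSubgroup (hβ : IsUniformizer β) (hS : IsResidueSystem S)
    {a : Fin m → K} (ha : ∀ i, a i ∈ S) : ∑ i, a i * β ^ (i : ℕ) ∈ ballSubgroup β 0 := by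
  refine sum_mem fun i _ => ?_
  rw [mem_ballSubgroup, zpow_zero, one_mul, map_mul, map_pow]
  exact mul_le_one' (hS.subset_integers _ (ha i)) (pow_le_one' hβ.valuation_lt_one.le _)

theorem IsResidueSystem.eq_of_valuation_sub_lt_one (hS : IsResidueSystem S) {a b : K}
    (ha : a ∈ S) (hb : b ∈ S) (hab : valuation K (a - b) < 1) : a = b :=
  (hS.existsUnique_rep a (hS.subset_integers a ha)).unique ⟨ha, by simp⟩ ⟨hb, hab⟩

variable [ValuativeRel.IsNontrivial K]

theorem exists_digits (hβ : IsUniformizer β) (hS : IsResidueSystem S) (m : ℕ)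
    (hx : x ∈ ballSubgroup β 0) : ∃ a : Fin m → K, (∀ i, a i ∈ S) ∧
      x - ∑ i, a i * β ^ (i : ℕ) ∈ ballSubgroup β (-m) := by
  induction m generalizing x with
  | zero => exact ⟨Fin.elim0, fun i => i.elim0, by simpa using hx⟩
  | succ m ih =>
    obtain ⟨s, ⟨hs, hxs⟩, -⟩ :=
      hS.existsUnique_rep x (by simpa [mem_ballSubgroup] using hx)
    obtain ⟨y, hy, hxy⟩ := (hβ _).1 hxs
    obtain ⟨a, ha, hya⟩ := ih (x := y) (by simpa [mem_ballSubgroup] using hy)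
    refine ⟨Fin.cons s a, Fin.cases hs ha, ?_⟩
    rw [sum_digits_succ, Fin.cons_zero, Fin.tail_cons, ← sub_sub, hxy, ← mul_sub,
      mul_left_mem_ballSubgroup hβ.ne_zero]
    simpa using hya

theorem digits_unique (hβ : IsUniformizer β) (hS : IsResidueSystem S)
    {a b : Fin m → K} (ha : ∀ i, a i ∈ S) (hb : ∀ i, b i ∈ S)
    (hab : ∑ i, a i * β ^ (i : ℕ) - ∑ i, b i * β ^ (i : ℕ) ∈ ballSubgroup β (-m)) : a = b := by
  induction m with
  | zero => exact Subsingleton.elim _ _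
  | succ m ih =>
    have h_tail : ∀ c : Fin (m + 1) → K, (∀ i, c i ∈ S) →
        β * ∑ i, Fin.tail c i * β ^ (i : ℕ) ∈ ballSubgroup β (-1) := fun c hc => by
      rw [mul_left_mem_ballSubgroup hβ.ne_zero]
      exact sum_digits_mem_ballSubgroup hβ hS fun i => hc i.succ
    rw [sum_digits_succ, sum_digits_succ] at hab
    have h_zero : a 0 = b 0 := by
      refine hS.eq_of_valuation_sub_lt_one (ha 0) (hb 0) ((hβ.valuation_lt_one_iff).2 ?_)
      have h_le : (-((m + 1 : ℕ) : ℤ)) ≤ -1 := by lia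
      have := sub_mem (ballSubgroup_mono hβ h_le hab) (sub_mem (h_tail a ha) (h_tail b hb))
      rwa [add_sub_add_comm, add_sub_cancel_right] at this
    rw [h_zero, add_sub_add_left_eq_sub, ← mul_sub,
      mul_left_mem_ballSubgroup hβ.ne_zero] at hab
    have h_succ : Fin.tail a = Fin.tail b :=
      ih (fun i => ha i.succ) (fun i => hb i.succ) (by simpa using hab)
    rw [← Fin.cons_self_tail a, ← Fin.cons_self_tail b, h_zero, h_succ]

end Digits

section Grid

variable {K : Type*} [Field K] {β x y : K} {S : Finset K} {n : ℕ}

theorem grid_eq_image [DecidableEq K] (hβ : β ≠ 0) (S : Finset K) (n : ℕ) :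
    grid β S n = (Fintype.piFinset fun _ : Fin (2 * n) => S).image
      fun a => β ^ (-n : ℤ) * ∑ i : Fin (2 * n), a i * β ^ (i : ℕ) := by
  unfold grid
  congr! 2 with a
  rw [Finset.mul_sum]
  refine Finset.sum_congr rfl fun i _ => ?_
  rw [sub_eq_neg_add, zpow_add₀ hβ, zpow_natCast, mul_left_comm]

theorem mem_grid (hβ : β ≠ 0) : x ∈ grid β S n ↔ ∃ a : Fin (2 * n) → K, (∀ i, a i ∈ S) ∧
    β ^ (-n : ℤ) * ∑ i, a i * β ^ (i : ℕ) = x := by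
  classical
  simp only [grid_eq_image hβ, Finset.mem_image, Fintype.mem_piFinset]

variable [ValuativeRel K]

theorem IsResidueSystem.zero_mem_grid (hS : IsResidueSystem S) : (0 : K) ∈ grid β S n := by
  classical
  exact Finset.mem_image.2 ⟨0, Fintype.mem_piFinset.2 fun _ => hS.zero_mem, by simp⟩

/-- The representative in `X_n` of the class of `x ∈ B_n` modulo `B_{-n}`; it identifies `X_n` with
the group `B_n / B_{-n}`. Outside `B_n` its value is `0`. -/
def gridRep (β : K) (S : Finset K) (n : ℕ) (x : K) : K :=
  open Classical in
  if h : ∃ y ∈ grid β S n, x - y ∈ ballSubgroup β (-n) then h.choose else 0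

theorem gridRep_mem_grid (hS : IsResidueSystem S) (x : K) : gridRep β S n x ∈ grid β S n := by
  unfold gridRep
  split_ifs with h
  · exact h.choose_spec.1
  · exact hS.zero_mem_grid

variable [ValuativeRel.IsNontrivial K]

theorem mem_ballSubgroup_of_mem_grid (hβ : IsUniformizer β)
    (hS : IsResidueSystem S) (hx : x ∈ grid β S n) : x ∈ ballSubgroup β n := by
  obtain ⟨a, ha, rfl⟩ := (mem_grid hβ.ne_zero).1 hx
  rw [zpow_mul_mem_ballSubgroup hβ.ne_zero, add_neg_cancel]
  exact sum_digits_mem_ballSubgroup hβ hS ha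

theorem exists_mem_grid_sub_mem (hβ : IsUniformizer β) (hS : IsResidueSystem S)
    (hx : x ∈ ballSubgroup β n) : ∃ y ∈ grid β S n, x - y ∈ ballSubgroup β (-n) := by
  have h_scaled : β ^ (n : ℤ) * x ∈ ballSubgroup β 0 := by
    rwa [zpow_mul_mem_ballSubgroup hβ.ne_zero, zero_add]
  obtain ⟨a, ha, hxa⟩ := exists_digits hβ hS (2 * n) h_scaled
  refine ⟨_, (mem_grid hβ.ne_zero).2 ⟨a, ha, rfl⟩, ?_⟩
  have h_eq : β ^ (n : ℤ) * x - ∑ i, a i * β ^ (i : ℕ) =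
      β ^ (n : ℤ) * (x - β ^ (-n : ℤ) * ∑ i, a i * β ^ (i : ℕ)) := by
    rw [mul_sub, zpow_neg, mul_inv_cancel_left₀ (zpow_ne_zero _ hβ.ne_zero)]
  rw [h_eq, zpow_mul_mem_ballSubgroup hβ.ne_zero] at hxa
  convert hxa using 2
  push_cast
  ring

theorem digits_eq_of_sub_mem (hβ : IsUniformizer β) (hS : IsResidueSystem S)
    {a b : Fin (2 * n) → K} (ha : ∀ i, a i ∈ S) (hb : ∀ i, b i ∈ S)
    (hab : β ^ (-n : ℤ) * ∑ i, a i * β ^ (i : ℕ) - β ^ (-n : ℤ) * ∑ i, b i * β ^ (i : ℕ) ∈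
      ballSubgroup β (-n)) : a = b := by
  rw [← mul_sub, zpow_mul_mem_ballSubgroup hβ.ne_zero] at hab
  refine digits_unique hβ hS ha hb ?_
  convert hab using 2
  push_cast
  ring

theorem eq_of_mem_grid_of_sub_mem (hβ : IsUniformizer β) (hS : IsResidueSystem S)
    (hx : x ∈ grid β S n) (hy : y ∈ grid β S n) (hxy : x - y ∈ ballSubgroup β (-n)) :
    x = y := by
  obtain ⟨a, ha, rfl⟩ := (mem_grid hβ.ne_zero).1 hx
  obtain ⟨b, hb, rfl⟩ := (mem_grid hβ.ne_zero).1 hy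
  rw [digits_eq_of_sub_mem hβ hS ha hb hxy]

theorem sub_gridRep_mem (hβ : IsUniformizer β) (hS : IsResidueSystem S)
    (hx : x ∈ ballSubgroup β n) : x - gridRep β S n x ∈ ballSubgroup β (-n) := by
  have h := exists_mem_grid_sub_mem hβ hS hx
  rw [gridRep, dif_pos h]
  exact h.choose_spec.2

theorem gridRep_eq_iff (hβ : IsUniformizer β) (hS : IsResidueSystem S)
    (hx : x ∈ ballSubgroup β n) (hy : y ∈ grid β S n) :
    gridRep β S n x = y ↔ x - y ∈ ballSubgroup β (-n) := by
  have h := sub_gridRep_mem hβ hS hx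
  refine ⟨fun e => e ▸ h, fun hxy => ?_⟩
  refine eq_of_mem_grid_of_sub_mem hβ hS (gridRep_mem_grid hS x) hy ?_
  simpa using sub_mem hxy h

theorem gridRep_of_mem_grid (hβ : IsUniformizer β) (hS : IsResidueSystem S) (hx : x ∈ grid β S n) :
    gridRep β S n x = x := by
  rw [gridRep_eq_iff hβ hS (mem_ballSubgroup_of_mem_grid hβ hS hx) hx, sub_self]
  exact zero_mem _

theorem valuation_gridRep_le (hβ : IsUniformizer β) (hS : IsResidueSystem S)
    (hx : x ∈ ballSubgroup β n) : valuation K (gridRep β S n x) ≤ valuation K x := by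
  by_cases hx₀ : x ∈ ballSubgroup β (-n)
  · rw [(gridRep_eq_iff hβ hS hx hS.zero_mem_grid).2 (by simpa using hx₀)]
    simp
  · have h_pos : 0 < valuation K (β ^ (-n : ℤ)) :=
      zero_lt_iff.2 ((Valuation.ne_zero_iff _).2 (zpow_ne_zero _ hβ.ne_zero))
    have h_sub : valuation K (x - gridRep β S n x) ≤ valuation K x := by
      have h_mul := (mem_ballSubgroup.1 (sub_gridRep_mem hβ hS hx)).trans
        (not_le.1 (mt mem_ballSubgroup.2 hx₀)).le
      rw [map_mul, map_mul] at h_mul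
      exact le_of_mul_le_mul_left h_mul h_pos
    simpa using (valuation K).map_sub_le le_rfl h_sub

end Grid

section LocalField

variable {K : Type*} [Field K] [ValuativeRel K] [TopologicalSpace K]
  [IsNonarchimedeanLocalField K] {β : K} {S : Finset K} {n : ℕ}

theorem IsResidueSystem.card_eq (hS : IsResidueSystem S) : S.card = residueCard K := by
  have h_residue_eq (x y : (valuation K).integer) :
      IsLocalRing.residue _ x = IsLocalRing.residue _ y ↔ valuation K ((x : K) - y) < 1 := by
    rw [← sub_eq_zero, ← map_sub, IsLocalRing.residue_eq_zero_iff, IsLocalRing.mem_maximalIdeal,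
      mem_nonunits_iff,
      Valuation.Integers.isUnit_iff_valuation_eq_one (Valuation.integer.integers (valuation K))]
    exact (lt_iff_le_and_ne.trans (and_iff_right (x - y).2)).symm
  rw [residueCard, ← Nat.card_eq_finsetCard]
  refine Nat.card_eq_of_bijective (fun s : S => IsLocalRing.residue _ ⟨s, hS.subset_integers s s.2⟩)
    ⟨fun s s' h => ?_, fun r => ?_⟩
  · exact Subtype.ext (hS.eq_of_valuation_sub_lt_one s.2 s'.2 ((h_residue_eq _ _).1 h))
  · obtain ⟨x, rfl⟩ := IsLocalRing.residue_surjective r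
    obtain ⟨s, ⟨hs, hxs⟩, -⟩ := hS.existsUnique_rep x x.2
    exact ⟨⟨s, hs⟩, ((h_residue_eq x ⟨s, hS.subset_integers _ hs⟩).2 hxs).symm⟩

theorem IsResidueSystem.residueCard_ne_zero (hS : IsResidueSystem S) : residueCard K ≠ 0 := by
  rw [← hS.card_eq]
  exact Finset.card_ne_zero_of_mem hS.zero_mem

theorem card_grid (hβ : IsUniformizer β) (hS : IsResidueSystem S) :
    (grid β S n).card = residueCard K ^ (2 * n) := by
  classical
  rw [grid_eq_image hβ.ne_zero, Finset.card_image_of_injOn, Fintype.card_piFinset_const,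
    hS.card_eq]
  intro a ha b hb hab
  rw [Finset.mem_coe, Fintype.mem_piFinset] at ha hb
  refine digits_eq_of_sub_mem hβ hS ha hb ?_
  rw [sub_eq_zero.2 hab]
  exact zero_mem _

variable (K) in
theorem integers_mem_nhds_zero : {x : K | valuation K x ≤ 1} ∈ 𝓝 (0 : K) :=
  (IsValuativeTopology.hasBasis_nhds_zero' K).mem_iff.2
    ⟨1, one_ne_zero, fun _ hx => (Set.mem_ofPred.1 hx).le⟩

theorem isOpen_ballSubgroup (β : K) (r : ℤ) : IsOpen (ballSubgroup β r : Set K) :=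
  (ballSubgroup β r).isOpen_of_mem_nhds <|
    (continuous_const_mul (β ^ r)).continuousAt.preimage_mem_nhds (x := 0)
      (by simpa using integers_mem_nhds_zero K)

theorem isClopen_ballSubgroup (β : K) (r : ℤ) : IsClopen (ballSubgroup β r : Set K) :=
  ⟨(ballSubgroup β r).isClosed_of_isOpen (isOpen_ballSubgroup β r), isOpen_ballSubgroup β r⟩

/-! ### The canonical absolute value -/

theorem canonicalAbs_mul (x y : K) : canonicalAbs (x * y) = canonicalAbs x * canonicalAbs y := by
  rcases eq_or_ne x 0 with rfl | hx
  · simp [canonicalAbs]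
  rcases eq_or_ne y 0 with rfl | hy
  · simp [canonicalAbs]
  rw [canonicalAbs, canonicalAbs, canonicalAbs, dif_neg hx, dif_neg hy, dif_neg (mul_ne_zero hx hy),
    Units.mk0_mul, map_mul, NNReal.coe_mul]

theorem canonicalAbs_nonneg (x : K) : 0 ≤ canonicalAbs x := by
  unfold canonicalAbs
  split_ifs
  · exact le_rfl
  · exact NNReal.coe_nonneg _

theorem canonicalAbs_le_one {x : K} (hx : valuation K x ≤ 1) : canonicalAbs x ≤ 1 := by
  borelize K
  rcases eq_or_ne x 0 with rfl | hx₀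
  · simp [canonicalAbs]
  rw [canonicalAbs, dif_neg hx₀]
  have h_pos : (Measure.addHaar : Measure K) {x : K | valuation K x ≤ 1} ≠ 0 :=
    (Measure.measure_pos_of_mem_nhds _ (integers_mem_nhds_zero K)).ne'
  have h_fin : (Measure.addHaar : Measure K) {x : K | valuation K x ≤ 1} ≠ ⊤ :=
    (IsNonarchimedeanLocalField.isCompact_closedBall K 1).measure_lt_top.ne
  have h_le : (distribHaarChar K (Units.mk0 x hx₀) : ENNReal) ≤ 1 := by
    rw [distribHaarChar_eq_div (μ := Measure.addHaar) h_pos h_fin]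
    refine ENNReal.div_le_of_le_mul ((measure_mono ?_).trans_eq (one_mul _).symm)
    rintro _ ⟨y, hy, rfl⟩
    exact ((valuation K).map_mul x y).trans_le (mul_le_one' hx hy)
  exact_mod_cast h_le

theorem canonicalAbs_le_of_valuation_le {x y : K} (hxy : valuation K x ≤ valuation K y) :
    canonicalAbs x ≤ canonicalAbs y := by
  rcases eq_or_ne y 0 with rfl | hy
  · rw [map_zero, le_zero_iff, Valuation.zero_iff] at hxy
    rw [hxy]
  · rw [← div_mul_cancel₀ x hy, canonicalAbs_mul]
    refine mul_le_of_le_one_left (canonicalAbs_nonneg y) (canonicalAbs_le_one ?_)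
    rw [map_div₀]
    exact div_le_one_of_le₀ hxy zero_le

theorem canonicalAbs_add_le_max (x y : K) :
    canonicalAbs (x + y) ≤ max (canonicalAbs x) (canonicalAbs y) := by
  rcases le_max_iff.1 ((valuation K).map_add x y) with h | h
  · exact le_max_of_le_left (canonicalAbs_le_of_valuation_le h)
  · exact le_max_of_le_right (canonicalAbs_le_of_valuation_le h)

end LocalField

/-! ### Characters on the grid and the jump weights -/

section LayerCake

theorem sum_sub_smul_nonneg_of_level {ι E : Type*} [NormedAddCommGroup E] [NormedSpace ℝ E]
    [CompleteSpace E] [PartialOrder E] [IsOrderedAddMonoid E] [IsOrderedModule ℝ E]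
    [ClosedIciTopology E] (T : Finset ι) {g : ι → ℝ} {C : ℝ} (F : ι → E)
    (hC : ∀ i ∈ T, g i ≤ C) (hF : ∀ ρ : ℝ, 0 ≤ ∑ i ∈ T with g i ≤ ρ, F i) :
    0 ≤ ∑ i ∈ T, (C - g i) • F i := by
  have h_layer : ∑ i ∈ T, (C - g i) • F i =
      ∫ ρ, ∑ i ∈ T, (Set.Icc (g i) C).indicator (fun _ => F i) ρ := by
    rw [integral_finsetSum _ fun i _ => (integrable_indicator_iff measurableSet_Icc).2
      (integrableOn_const measure_Icc_lt_top.ne)]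
    refine Finset.sum_congr rfl fun i hi => ?_
    rw [integral_indicator_const _ measurableSet_Icc, Real.volume_real_Icc_of_le (hC i hi)]
  rw [h_layer]
  refine integral_nonneg fun ρ => ?_
  rcases le_or_gt ρ C with hρ | hρ
  · simpa [Set.indicator_apply, hρ, Finset.sum_filter] using hF ρ
  · simp [hρ.not_ge]

end LayerCake

section Characters

variable {K : Type*} [Field K] [ValuativeRel K] {β : K} {S : Finset K} {n : ℕ}
  {χ : AddChar K Circle} {x y z : K}

theorem HasRankZero.eq_one (hχ : HasRankZero β χ) (hx : x ∈ ballSubgroup β 0) : χ x = 1 :=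
  hχ.1 x hx

variable [ValuativeRel.IsNontrivial K]

theorem map_mul_gridRep (hβ : IsUniformizer β) (hS : IsResidueSystem S) (hχ : HasRankZero β χ)
    (hx : x ∈ ballSubgroup β n) (hy : y ∈ ballSubgroup β n) :
    χ (x * gridRep β S n y) = χ (x * y) := by
  have h_sub : x * (y - gridRep β S n y) ∈ ballSubgroup β 0 := by
    simpa using mul_mem_ballSubgroup hβ.ne_zero hx (sub_gridRep_mem hβ hS hy)
  rw [← sub_add_cancel y (gridRep β S n y), mul_add, AddChar.map_add_eq_mul, hχ.eq_one h_sub,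
    one_mul, sub_add_cancel]

theorem injOn_gridRep_add (hβ : IsUniformizer β) (hS : IsResidueSystem S)
    (hx : x ∈ ballSubgroup β n) :
    Set.InjOn (fun ξ => gridRep β S n (ξ + x)) (grid β S n) := by
  intro ξ hξ η hη h_eq
  rw [Finset.mem_coe] at hξ hη
  have h_sub {ζ : K} (hζ : ζ ∈ grid β S n) :
      ζ + x - gridRep β S n (ζ + x) ∈ ballSubgroup β (-n) :=
    sub_gridRep_mem hβ hS (add_mem (mem_ballSubgroup_of_mem_grid hβ hS hζ) hx)
  refine eq_of_mem_grid_of_sub_mem hβ hS hξ hη ?_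
  have h := sub_mem (h_sub hξ) (h_sub hη)
  rwa [show gridRep β S n (ξ + x) = gridRep β S n (η + x) from h_eq, sub_sub_sub_cancel_right,
    add_sub_add_right_eq_sub] at h

theorem sum_char_eq_zero (hβ : IsUniformizer β) (hS : IsResidueSystem S) (hχ : HasRankZero β χ)
    {T : Finset K} (hT : T ⊆ grid β S n)
    (h_add : ∀ ξ ∈ T, ∀ η ∈ T, gridRep β S n (ξ + η) ∈ T) (hz : z ∈ ballSubgroup β n)
    {η : K} (hη : η ∈ T) (h_ne : χ (z * η) ≠ 1) : ∑ ξ ∈ T, (χ (z * ξ) : ℂ) = 0 := by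
  have h_ball {ξ : K} (hξ : ξ ∈ T) : ξ ∈ ballSubgroup β n :=
    mem_ballSubgroup_of_mem_grid hβ hS (hT hξ)
  have h_maps : Set.MapsTo (fun ξ => gridRep β S n (ξ + η)) T T := fun ξ hξ => h_add ξ hξ η hη
  have h_inj : Set.InjOn (fun ξ => gridRep β S n (ξ + η)) T :=
    (injOn_gridRep_add hβ hS (h_ball hη)).mono hT
  have h_translate :
      ∑ ξ ∈ T, (χ (z * ξ) : ℂ) * χ (z * η) = ∑ ξ ∈ T, (χ (z * ξ) : ℂ) := by
    refine Finset.sum_nbij (fun ξ => gridRep β S n (ξ + η)) h_maps h_inj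
      (Finset.surjOn_of_injOn_of_card_le _ h_maps h_inj le_rfl) fun ξ hξ => ?_
    rw [map_mul_gridRep hβ hS hχ hz (add_mem (h_ball hξ) (h_ball hη)), mul_add,
      AddChar.map_add_eq_mul, Circle.coe_mul]
  rw [← Finset.sum_mul] at h_translate
  by_contra h_sum
  exact h_ne (Circle.coe_eq_one.1 ((mul_eq_left₀ h_sum).1 h_translate))

theorem exists_mem_grid_char_ne_one (hβ : IsUniformizer β) (hS : IsResidueSystem S)
    (hχ : HasRankZero β χ) (hx : x ∈ ballSubgroup β n) (hx' : x ∉ ballSubgroup β (-n)) :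
    ∃ ξ ∈ grid β S n, χ (x * ξ) ≠ 1 := by
  have h_rank : ¬ ∀ y ∈ ball β 1, χ y = 1 := fun h => absurd (hχ.2 h) (by norm_num)
  push Not at h_rank
  obtain ⟨y, hy, h_ne⟩ := h_rank
  have hx₀ : x ≠ 0 := by
    rintro rfl
    exact hx' (zero_mem _)
  have h_div : y * x⁻¹ ∈ ballSubgroup β n := by
    convert mul_mem_ballSubgroup hβ.ne_zero (s := -(-n : ℤ) - 1) (show y ∈ ballSubgroup β 1 from hy)
      (inv_mem_ballSubgroup_of_notMem hβ hx') using 2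
    ring
  refine ⟨_, gridRep_mem_grid hS (y * x⁻¹), ?_⟩
  rwa [map_mul_gridRep hβ hS hχ hx h_div, mul_comm y, mul_inv_cancel_left₀ hx₀]

end Characters

section LocalFieldCharacters

variable {K : Type*} [Field K] [ValuativeRel K] [TopologicalSpace K]
  [IsNonarchimedeanLocalField K] {β : K} {S : Finset K} {n : ℕ} {χ : AddChar K Circle} {z : K}

theorem sum_char_grid (hβ : IsUniformizer β) (hS : IsResidueSystem S) (hχ : HasRankZero β χ)
    (hz : z ∈ ballSubgroup β n) [Decidable (z ∈ ballSubgroup β (-n))] :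
    ∑ ξ ∈ grid β S n, (χ (z * ξ) : ℂ) =
      if z ∈ ballSubgroup β (-n) then (residueCard K : ℂ) ^ (2 * n) else 0 := by
  split_ifs with hz'
  · have h_one : ∀ ξ ∈ grid β S n, (χ (z * ξ) : ℂ) = 1 := fun ξ hξ => by
      have h := mul_mem_ballSubgroup hβ.ne_zero hz' (mem_ballSubgroup_of_mem_grid hβ hS hξ)
      rw [neg_add_cancel] at h
      rw [hχ.eq_one h, Circle.coe_one]
    simp [Finset.sum_congr rfl h_one, card_grid hβ hS]
  · obtain ⟨η, hη, h_ne⟩ := exists_mem_grid_char_ne_one hβ hS hχ hz hz'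
    exact sum_char_eq_zero hβ hS hχ subset_rfl (fun _ _ _ _ => gridRep_mem_grid hS _) hz hη h_ne

theorem sum_char_grid_sub (hβ : IsUniformizer β) (hS : IsResidueSystem S)
    (hχ : HasRankZero β χ) {x y : K} (hx : x ∈ grid β S n) (hy : y ∈ grid β S n)
    [Decidable (x = y)] :
    ∑ ξ ∈ grid β S n, (χ ((x - y) * ξ) : ℂ) =
      if x = y then (residueCard K : ℂ) ^ (2 * n) else 0 := by
  classical
  have h_mem : x - y ∈ ballSubgroup β (-n) ↔ x = y :=
    ⟨eq_of_mem_grid_of_sub_mem hβ hS hx hy, fun h => by simp [h]⟩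
  simp only [sum_char_grid hβ hS hχ (sub_mem (mem_ballSubgroup_of_mem_grid hβ hS hx)
    (mem_ballSubgroup_of_mem_grid hβ hS hy)), h_mem]

theorem canonicalAbs_gridRep_add_le (hβ : IsUniformizer β) (hS : IsResidueSystem S) {ξ η : K}
    (hξ : ξ ∈ grid β S n) (hη : η ∈ grid β S n) :
    canonicalAbs (gridRep β S n (ξ + η)) ≤ max (canonicalAbs ξ) (canonicalAbs η) :=
  (canonicalAbs_le_of_valuation_le (valuation_gridRep_le hβ hS (add_mem
    (mem_ballSubgroup_of_mem_grid hβ hS hξ) (mem_ballSubgroup_of_mem_grid hβ hS hη)))).trans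
    (canonicalAbs_add_le_max ξ η)

open scoped ComplexOrder

theorem sum_char_level_nonneg (hβ : IsUniformizer β) (hS : IsResidueSystem S)
    (hχ : HasRankZero β χ) {α : ℝ} (hα : 0 ≤ α) (hz : z ∈ ballSubgroup β n) (ρ : ℝ) :
    0 ≤ ∑ ξ ∈ grid β S n with canonicalAbs ξ ^ α ≤ ρ, (χ (z * ξ) : ℂ) := by
  set T := {ξ ∈ grid β S n | canonicalAbs ξ ^ α ≤ ρ}
  by_cases h_all : ∀ ξ ∈ T, χ (z * ξ) = 1
  · rw [Finset.sum_congr rfl fun ξ hξ => by rw [h_all ξ hξ, Circle.coe_one]]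
    simp
  · push Not at h_all
    obtain ⟨η, hη, h_ne⟩ := h_all
    refine (sum_char_eq_zero hβ hS hχ (Finset.filter_subset _ _) ?_ hz hη h_ne).ge
    intro ξ hξ η hη
    rw [Finset.mem_filter] at hξ hη ⊢
    refine ⟨gridRep_mem_grid hS _, ?_⟩
    rcases le_max_iff.1 (canonicalAbs_gridRep_add_le hβ hS hξ.1 hη.1) with h | h
    · exact (Real.rpow_le_rpow (canonicalAbs_nonneg _) h hα).trans hξ.2
    · exact (Real.rpow_le_rpow (canonicalAbs_nonneg _) h hα).trans hη.2

/-- The total rate of the jumps of the path process. Any constant that is at least all the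
`|ξ| ^ α`, `ξ ∈ X_n`, would do: its choice affects only the rate of the jumps by `0`. -/
def totalJumpRate (β : K) (S : Finset K) (n : ℕ) (α : ℝ) : ℝ :=
  ∑ ξ ∈ grid β S n, canonicalAbs ξ ^ α

/-- The rate of the jumps by `z ∈ X_n` of the path process, which is the inverse Fourier transform
`q ^ (-2n) ∑ ξ, (C - |ξ| ^ α) χ (z ξ)` with the total rate `C`; this number is real by
`jumpRate_eq`. -/
def jumpRate (β : K) (S : Finset K) (n : ℕ) (χ : AddChar K Circle) (α : ℝ) (z : K) : ℝ :=
  (((residueCard K : ℂ) ^ (2 * n))⁻¹ * ∑ ξ ∈ grid β S n,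
    (totalJumpRate β S n α - canonicalAbs ξ ^ α) • (χ (z * ξ) : ℂ)).re

theorem fourier_totalJumpRate_sub_nonneg (hβ : IsUniformizer β) (hS : IsResidueSystem S)
    (hχ : HasRankZero β χ) {α : ℝ} (hα : 0 ≤ α) (hz : z ∈ grid β S n) :
    0 ≤ ((residueCard K : ℂ) ^ (2 * n))⁻¹ * ∑ ξ ∈ grid β S n,
      (totalJumpRate β S n α - canonicalAbs ξ ^ α) • (χ (z * ξ) : ℂ) := by
  refine mul_nonneg (inv_nonneg.2 (by positivity)) (sum_sub_smul_nonneg_of_level _ _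
    (fun ξ hξ => ?_) (sum_char_level_nonneg hβ hS hχ hα (mem_ballSubgroup_of_mem_grid hβ hS hz)))
  exact Finset.single_le_sum (f := fun ξ => canonicalAbs ξ ^ α)
    (fun ξ _ => Real.rpow_nonneg (canonicalAbs_nonneg ξ) α) hξ

theorem jumpRate_nonneg (hβ : IsUniformizer β) (hS : IsResidueSystem S)
    (hχ : HasRankZero β χ) {α : ℝ} (hα : 0 ≤ α) (hz : z ∈ grid β S n) :
    0 ≤ jumpRate β S n χ α z :=
  (Complex.nonneg_iff.1 (fourier_totalJumpRate_sub_nonneg hβ hS hχ hα hz)).1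

theorem jumpRate_eq (hβ : IsUniformizer β) (hS : IsResidueSystem S)
    (hχ : HasRankZero β χ) {α : ℝ} (hα : 0 ≤ α) (hz : z ∈ grid β S n) :
    (jumpRate β S n χ α z : ℂ) = ((residueCard K : ℂ) ^ (2 * n))⁻¹ * ∑ ξ ∈ grid β S n,
      (totalJumpRate β S n α - canonicalAbs ξ ^ α) • (χ (z * ξ) : ℂ) :=
  (Complex.eq_re_of_ofReal_le (r := 0)
    (by simpa using fourier_totalJumpRate_sub_nonneg hβ hS hχ hα hz)).symm

theorem sum_jumpRate_mul_char (hβ : IsUniformizer β) (hS : IsResidueSystem S)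
    (hχ : HasRankZero β χ) {α : ℝ} (hα : 0 ≤ α) {η : K} (hη : η ∈ grid β S n) :
    ∑ z ∈ grid β S n, (jumpRate β S n χ α z : ℂ) * (χ (-(η * z)) : ℂ) =
      ((totalJumpRate β S n α - canonicalAbs η ^ α : ℝ) : ℂ) := by
  classical
  have hq : (residueCard K : ℂ) ^ (2 * n) ≠ 0 :=
    pow_ne_zero _ (Nat.cast_ne_zero.2 hS.residueCard_ne_zero)
  have h_term : ∀ z ∈ grid β S n, (jumpRate β S n χ α z : ℂ) * (χ (-(η * z)) : ℂ) =
      ((residueCard K : ℂ) ^ (2 * n))⁻¹ * ∑ ξ ∈ grid β S n,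
        ((totalJumpRate β S n α - canonicalAbs ξ ^ α : ℝ) : ℂ) * (χ ((ξ - η) * z) : ℂ) := by
    intro z hz
    rw [jumpRate_eq hβ hS hχ hα hz, mul_assoc, Finset.sum_mul]
    congr 1
    refine Finset.sum_congr rfl fun ξ _ => ?_
    rw [Complex.real_smul, mul_assoc, ← Circle.coe_mul, ← AddChar.map_add_eq_mul, mul_comm z,
      ← sub_eq_add_neg, ← sub_mul]
  rw [Finset.sum_congr rfl h_term, ← Finset.mul_sum, Finset.sum_comm]
  simp_rw [← Finset.mul_sum]
  rw [Finset.sum_congr rfl fun ξ hξ => by rw [sum_char_grid_sub hβ hS hχ hξ hη, mul_ite, mul_zero],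
    Finset.sum_ite_eq', if_pos hη, mul_comm, mul_assoc, mul_inv_cancel₀ hq, mul_one]

end LocalFieldCharacters

/-! ### Compound Poisson paths -/

section Poissonization

variable {E X : Type*} [MeasurableSpace E] [MeasurableSpace X]

/-- The law of a Poisson point process with intensity `μ`: a Poisson number of points with mean
`μ E`, which are independent with distribution proportional to `μ`. A configuration of points is
encoded by their number together with an enumeration. -/
def poissonization (μ : Measure E) : Measure (Σ k : ℕ, Fin k → E) :=
  ENNReal.ofReal (Real.exp (-μ.real Set.univ)) • Measure.sum fun k =>
    ((k.factorial : ENNReal)⁻¹) • (Measure.pi fun _ : Fin k => μ).map (Sigma.mk k)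

theorem measurable_sigmaMk {ι : Type*} {F : ι → Type*} [∀ i, MeasurableSpace (F i)] (i : ι) :
    Measurable (Sigma.mk i : F i → Σ i, F i) :=
  Measurable.of_le_map (iInf_le _ i)

theorem measurable_of_comp_sigmaMk {ι : Type*} {F : ι → Type*} [∀ i, MeasurableSpace (F i)]
    {f : (Σ i, F i) → X} (hf : ∀ i, Measurable fun x => f ⟨i, x⟩) : Measurable f :=
  Measurable.of_comap_le (le_iInf fun i => by
    rw [MeasurableSpace.comap_le_iff_le_map, MeasurableSpace.map_comp]
    exact (hf i).le_map)

theorem measurable_prod_sigma {f : E → ℂ} (hf : Measurable f) :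
    Measurable fun p : Σ k : ℕ, Fin k → E => ∏ j, f (p.2 j) := by
  refine measurable_of_comp_sigmaMk fun k => ?_
  change Measurable fun x : Fin k → E => ∏ j, f (x j)
  fun_prop

variable (μ : Measure E) [IsFiniteMeasure μ] {f : E → ℂ}

theorem integrable_prod_sum_pi (hf : Measurable f) (hfi : Integrable f μ) :
    Integrable (fun p : Σ k : ℕ, Fin k → E => ∏ j, f (p.2 j)) (Measure.sum fun k =>
      ((k.factorial : ENNReal)⁻¹) • (Measure.pi fun _ : Fin k => μ).map (Sigma.mk k)) := by
  refine integrable_sum_measure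
    (fun k => Integrable.smul_measure ?_ (by simp [k.factorial_ne_zero])) ?_
  · rw [integrable_map_measure (measurable_prod_sigma hf).aestronglyMeasurable
      (measurable_sigmaMk k).aemeasurable]
    exact Integrable.fintype_prod fun _ => hfi
  · refine (Real.summable_pow_div_factorial (∫ x, ‖f x‖ ∂μ)).congr fun k => ?_
    rw [integral_smul_measure, integral_map (measurable_sigmaMk k).aemeasurable
      (measurable_prod_sigma hf).norm.aestronglyMeasurable]
    simp [norm_prod, integral_fintype_prod_eq_pow fun x => ‖f x‖, div_eq_inv_mul]

theorem integral_prod_poissonization (hf : Measurable f) (hfi : Integrable f μ) :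
    ∫ p, ∏ j, f (p.2 j) ∂(poissonization μ) = Complex.exp (∫ x, (f x - 1) ∂μ) := by
  have h_term (k : ℕ) : ∫ p : Σ k : ℕ, Fin k → E, ∏ j, f (p.2 j)
      ∂(((k.factorial : ENNReal)⁻¹) • (Measure.pi fun _ : Fin k => μ).map (Sigma.mk k)) =
        (∫ x, f x ∂μ) ^ k / (k.factorial : ℂ) := by
    rw [integral_smul_measure, integral_map (measurable_sigmaMk k).aemeasurable
      (measurable_prod_sigma hf).aestronglyMeasurable]
    simp [integral_fintype_prod_eq_pow, div_eq_inv_mul]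
  rw [poissonization, integral_smul_measure,
    integral_sum_measure (integrable_prod_sum_pi μ hf hfi), funext h_term,
    ENNReal.toReal_ofReal (Real.exp_nonneg _), Complex.real_smul, Complex.ofReal_exp,
    ← congrFun NormedSpace.exp_eq_tsum_div (∫ x, f x ∂μ), ← Complex.exp_eq_exp_ℂ,
    ← Complex.exp_add, integral_sub hfi (integrable_const 1), integral_const, Complex.real_smul,
    mul_one, Complex.ofReal_neg, neg_add_eq_sub]

instance isProbabilityMeasure_poissonization : IsProbabilityMeasure (poissonization μ) := by
  have h := integral_prod_poissonization μ (f := 1) measurable_const (integrable_const 1)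
  simp only [Pi.one_apply, Finset.prod_const_one, sub_self, integral_zero, Complex.exp_zero,
    integral_const, Complex.real_smul, mul_one, Complex.ofReal_eq_one] at h
  exact ⟨ENNReal.toReal_eq_one_iff _ |>.1 h⟩

end Poissonization

/-! ### Paths with finitely many jumps -/

section JumpPaths

theorem eventually_le_iff_nhdsGT {T : Type*} [LinearOrder T] [TopologicalSpace T]
    [OrderTopology T] (u s : T) : ∀ᶠ r in 𝓝[>] s, (u ≤ r ↔ u ≤ s) := by
  rcases le_or_gt u s with h | h
  · filter_upwards [self_mem_nhdsWithin] with r hr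
    exact iff_of_true (h.trans (Set.mem_Ioi.1 hr).le) h
  · filter_upwards [nhdsWithin_le_nhds (Iio_mem_nhds h)] with r hr
    exact iff_of_false (not_le.2 hr) (not_le.2 h)

theorem eventually_le_iff_nhdsLT {T : Type*} [LinearOrder T] [TopologicalSpace T]
    [OrderTopology T] (u s : T) : ∀ᶠ r in 𝓝[<] s, (u ≤ r ↔ u < s) := by
  rcases lt_or_ge u s with h | h
  · filter_upwards [nhdsWithin_le_nhds (Ioi_mem_nhds h)] with r hr
    exact iff_of_true (le_of_lt hr) h
  · filter_upwards [self_mem_nhdsWithin] with r hr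
    exact iff_of_false (not_le.2 ((Set.mem_Iio.1 hr).trans_le h)) (not_lt.2 h)

/-- The configurations of finitely many jump times in `(0,t)`, each with a jump from `D`. -/
abbrev JumpConfiguration {A : Type*} (D : Finset A) (t : ℝ) : Type _ :=
  Σ k : ℕ, Fin k → Set.Ioo (0 : ℝ) t × D

variable {A : Type*} [AddCommGroup A] {D : Finset A} {t : ℝ}

/-- The position at the time `s` of the path that starts at `a` and jumps at the times
`(p.2 j).1` by `(p.2 j).2`. -/
def jumpSum (a : A) (p : JumpConfiguration D t) (s : ℝ) : A :=
  a + ∑ j, (Set.Iic s).indicator (fun _ => ((p.2 j).2 : A)) (p.2 j).1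

theorem jumpSum_zero (a : A) (p : JumpConfiguration D t) :
    jumpSum a p 0 = a := by
  refine add_eq_left.2 (Finset.sum_eq_zero fun j _ => Set.indicator_of_notMem ?_ _)
  exact not_le.2 (p.2 j).1.2.1

theorem jumpSum_mem {H : AddSubgroup A} {a : A} (ha : a ∈ H) (hD : ∀ z ∈ D, z ∈ H)
    (p : JumpConfiguration D t) (s : ℝ) : jumpSum a p s ∈ H := by
  refine add_mem ha (sum_mem fun j _ => ?_)
  rw [Set.indicator_apply]
  split_ifs
  exacts [hD _ (p.2 j).2.2, zero_mem H]

theorem jumpSum_sub (a : A) (p : JumpConfiguration D t) {r s : ℝ} (h : r ≤ s) :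
    jumpSum a p s - jumpSum a p r =
      ∑ j, (Set.Ioc r s).indicator (fun _ => ((p.2 j).2 : A)) (p.2 j).1 := by
  rw [jumpSum, jumpSum, add_sub_add_left_eq_sub, ← Finset.sum_sub_distrib]
  refine Finset.sum_congr rfl fun j _ => ?_
  rw [← Set.Iic_union_Ioc_eq_Iic h, Set.indicator_union_of_disjoint (Set.Iic_disjoint_Ioc le_rfl),
    add_sub_cancel_left]

theorem eventually_jumpSum_nhdsGT (a : A) (p : JumpConfiguration D t)
    (s : Set.Icc (0 : ℝ) t) : ∀ᶠ r : Set.Icc (0 : ℝ) t in 𝓝[>] s,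
      jumpSum a p r = jumpSum a p s := by
  have h_iff : ∀ᶠ r : Set.Icc (0 : ℝ) t in 𝓝[>] s, ∀ j,
      ((p.2 j).1 : ℝ) ≤ r ↔ ((p.2 j).1 : ℝ) ≤ s :=
    eventually_all.2 fun j => eventually_le_iff_nhdsGT ⟨_, Set.Ioo_subset_Icc_self (p.2 j).1.2⟩ s
  filter_upwards [h_iff] with r hr
  simp only [jumpSum, Set.indicator_apply, Set.mem_Iic, hr]

theorem eventually_jumpSum_nhdsLT (a : A) (p : JumpConfiguration D t)
    (s : Set.Icc (0 : ℝ) t) : ∀ᶠ r : Set.Icc (0 : ℝ) t in 𝓝[<] s,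
      jumpSum a p r =
        a + ∑ j, (Set.Iio (s : ℝ)).indicator (fun _ => ((p.2 j).2 : A)) (p.2 j).1 := by
  have h_iff : ∀ᶠ r : Set.Icc (0 : ℝ) t in 𝓝[<] s, ∀ j,
      ((p.2 j).1 : ℝ) ≤ r ↔ ((p.2 j).1 : ℝ) < s :=
    eventually_all.2 fun j => eventually_le_iff_nhdsLT ⟨_, Set.Ioo_subset_Icc_self (p.2 j).1.2⟩ s
  filter_upwards [h_iff] with r hr
  simp only [jumpSum, Set.indicator_apply, Set.mem_Iic, Set.mem_Iio, hr]

theorem eventually_jumpSum_nhdsLT_of_eq (a : A) (p : JumpConfiguration D t)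
    {s : Set.Icc (0 : ℝ) t} (hs : (s : ℝ) = t) : ∀ᶠ r : Set.Icc (0 : ℝ) t in 𝓝[<] s,
      jumpSum a p r = jumpSum a p s := by
  filter_upwards [eventually_jumpSum_nhdsLT a p s] with r hr
  have h_lt (j) : ((p.2 j).1 : ℝ) < s := by
    rw [hs]
    exact (p.2 j).1.2.2
  rw [hr, jumpSum]
  simp only [Set.indicator_apply, Set.mem_Iic, Set.mem_Iio, h_lt, (h_lt _).le]

/-- The path `s ↦ f (jumpSum a p s)`. It is left continuous at `t` because the jump times
lie in the open interval `(0,t)`. -/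
def jumpPath {X : Type*} [TopologicalSpace X] (f : A → X) (a : A)
    (p : JumpConfiguration D t) : skorokhod X t :=
  ⟨fun s => f (jumpSum a p s),
    fun s _ => tendsto_const_nhds.congr' ((eventually_jumpSum_nhdsGT a p s).mono fun _ hr =>
      congrArg f hr.symm),
    fun s _ => ⟨_, tendsto_const_nhds.congr' ((eventually_jumpSum_nhdsLT a p s).mono fun _ hr =>
      congrArg f hr.symm)⟩,
    fun _ hs => tendsto_const_nhds.congr' ((eventually_jumpSum_nhdsLT_of_eq a p hs).mono
      fun _ hr => congrArg f hr.symm)⟩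

variable [MeasurableSpace A] [MeasurableSingletonClass A]

theorem measurable_comp_jumpSum {X : Type*} [MeasurableSpace X] (f : A → X) (a : A) (s : ℝ) :
    Measurable fun p : JumpConfiguration D t => f (jumpSum a p s) := by
  classical
  refine measurable_of_comp_sigmaMk fun k => ?_
  let g : (Fin k → Prop × D) → X := fun η => f (a + ∑ j, if (η j).1 then ((η j).2 : A) else 0)
  let φ : (Fin k → Set.Ioo (0 : ℝ) t × D) → Fin k → Prop × D :=
    fun x j => (((x j).1 : ℝ) ≤ s, (x j).2)
  have hφ : Measurable φ := by
    refine measurable_pi_lambda _ fun j => Measurable.prodMk ?_ (by fun_prop)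
    exact measurableSet_setOfPred.1 (measurableSet_le (by fun_prop) measurable_const)
  exact (Measurable.of_discrete (f := g)).comp hφ

theorem measurable_jumpPath {X : Type*} [TopologicalSpace X] [MeasurableSpace X] (f : A → X)
    (a : A) : Measurable fun p : JumpConfiguration D t => jumpPath f a p := by
  refine Measurable.subtype_mk (measurable_pi_lambda _ fun s => ?_)
  exact measurable_comp_jumpSum f a s

end JumpPaths

section Increments

theorem prod_sub_one_eq_sum_sub_one {ι R : Type*} [CommRing R] (s : Finset ι) {g : ι → R}
    (hg : ∀ i ∈ s, ∀ j ∈ s, g i ≠ 1 → g j ≠ 1 → i = j) :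
    ∏ i ∈ s, g i - 1 = ∑ i ∈ s, (g i - 1) := by
  by_cases h : ∃ i ∈ s, g i ≠ 1
  · obtain ⟨i, hi, hi'⟩ := h
    have h_other : ∀ j ∈ s, j ≠ i → g j = 1 := fun j hj hji =>
      not_not.1 fun hj' => hji (hg j hj i hi hj' hi')
    rw [Finset.prod_eq_single_of_mem i hi h_other, Finset.sum_eq_single_of_mem i hi fun j hj hji =>
      sub_eq_zero.2 (h_other j hj hji)]
  · push Not at h
    rw [Finset.prod_eq_one h, Finset.sum_eq_zero fun i hi => sub_eq_zero.2 (h i hi), sub_self]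

theorem eq_of_mem_Ioc_castSucc {N : ℕ} {T : Fin (N + 1) → ℝ} (hT : Monotone T) {u : ℝ}
    {i j : Fin N} (hi : u ∈ Set.Ioc (T i.castSucc) (T i.succ))
    (hj : u ∈ Set.Ioc (T j.castSucc) (T j.succ)) : i = j := by
  by_contra h_ne
  have h_disjoint := hT.pairwise_disjoint_on_Ioc_succ ((Fin.castSucc_injective N).ne h_ne)
  simp only [Function.onFun, Fin.orderSucc_castSucc] at h_disjoint
  exact Set.disjoint_left.1 h_disjoint hi hj

theorem coe_addChar_sum {A ι : Type*} [AddCommMonoid A] (ψ : AddChar A Circle) (s : Finset ι)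
    (f : ι → A) : (ψ (∑ i ∈ s, f i) : ℂ) = ∏ i ∈ s, (ψ (f i) : ℂ) := by
  induction s using Finset.cons_induction with
  | empty => simp
  | cons i s hi ih => rw [Finset.sum_cons, Finset.prod_cons, AddChar.map_add_eq_mul,
      Circle.coe_mul, ih]

variable {A : Type*} [AddCommGroup A] {D : Finset A} {t : ℝ} {N : ℕ} {T : Fin (N + 1) → ℝ}

theorem prod_char_jumpSum_sub (a : A) (p : JumpConfiguration D t) (hT : Monotone T)
    (ψ : Fin N → AddChar A Circle) :
    ∏ i, (ψ i (jumpSum a p (T i.succ) - jumpSum a p (T i.castSucc)) : ℂ) =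
      ∏ j, ∏ i, (ψ i ((Set.Ioc (T i.castSucc) (T i.succ)).indicator
        (fun _ => ((p.2 j).2 : A)) (p.2 j).1) : ℂ) := by
  rw [Finset.prod_comm]
  refine Finset.prod_congr rfl fun i _ => ?_
  rw [jumpSum_sub a p (hT Fin.castSucc_lt_succ.le), coe_addChar_sum]

theorem prod_char_indicator_sub_one (hT : Monotone T) (ψ : Fin N → AddChar A Circle)
    (x : ℝ × A) : ∏ i, (ψ i ((Set.Ioc (T i.castSucc) (T i.succ)).indicator (fun _ => x.2) x.1) : ℂ)
      - 1 = ∑ i, (Set.Ioc (T i.castSucc) (T i.succ)).indicator 1 x.1 * ((ψ i x.2 : ℂ) - 1) := by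
  have h_active {i : Fin N} (hi : (ψ i ((Set.Ioc (T i.castSucc) (T i.succ)).indicator
      (fun _ => x.2) x.1) : ℂ) ≠ 1) : x.1 ∈ Set.Ioc (T i.castSucc) (T i.succ) := by
    by_contra h
    simp [Set.indicator_of_notMem h] at hi
  rw [prod_sub_one_eq_sum_sub_one _ fun i _ j _ hi hj =>
    eq_of_mem_Ioc_castSucc hT (h_active hi) (h_active hj)]
  refine Finset.sum_congr rfl fun i _ => ?_
  by_cases h : x.1 ∈ Set.Ioc (T i.castSucc) (T i.succ) <;> simp [h]

variable [MeasurableSpace A] [MeasurableSingletonClass A]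

/-- The law of the configuration of jumps of a compound Poisson process on `[0,t]`, with jumps at
rate `ν`. -/
def jumpConfigurationLaw (t : ℝ) (ν : Measure D) : Measure (JumpConfiguration D t) :=
  poissonization ((volume.comap Subtype.val).prod ν)

instance (a b : ℝ) :
    IsFiniteMeasure (volume.comap (Subtype.val : Set.Ioo a b → ℝ)) :=
  ⟨by
    rw [comap_subtype_coe_apply measurableSet_Ioo, Subtype.coe_image_univ]
    exact measure_Ioo_lt_top⟩

variable (ν : Measure D) [IsFiniteMeasure ν]

instance : IsProbabilityMeasure (jumpConfigurationLaw t ν) :=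
  isProbabilityMeasure_poissonization _

theorem integral_indicator_Ioc_comap {r s : ℝ} (hr : 0 ≤ r) (hrs : r ≤ s) (hs : s ≤ t) :
    ∫ u : Set.Ioo 0 t, (Set.Ioc r s).indicator (1 : ℝ → ℂ) u ∂(volume.comap Subtype.val) =
      (s - r : ℝ) := by
  rw [integral_subtype_comap measurableSet_Ioo, setIntegral_congr_set Ioo_ae_eq_Ioc,
    setIntegral_indicator measurableSet_Ioc, Set.inter_eq_right.2 (Set.Ioc_subset_Ioc hr hs)]
  simp [hrs]

theorem integral_prod_char_jumpSum_sub (a : A) (hT : Monotone T) (hT₀ : 0 ≤ T 0)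
    (hTt : T (Fin.last N) ≤ t) (ψ : Fin N → AddChar A Circle) :
    ∫ p, ∏ i, (ψ i (jumpSum a p (T i.succ) - jumpSum a p (T i.castSucc)) : ℂ)
        ∂(jumpConfigurationLaw t ν) =
      Complex.exp (∑ i, (T i.succ - T i.castSucc : ℝ) * ∫ z, ((ψ i z : ℂ) - 1) ∂ν) := by
  let I (i : Fin N) (u : Set.Ioo (0 : ℝ) t) : ℂ :=
    (Set.Ioc (T i.castSucc) (T i.succ)).indicator 1 (u : ℝ)
  let c (i : Fin N) (z : D) : ℂ := ψ i z - 1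
  let f : Set.Ioo (0 : ℝ) t × D → ℂ := fun x => ∏ i,
    (ψ i ((Set.Ioc (T i.castSucc) (T i.succ)).indicator (fun _ => (x.2 : A)) x.1) : ℂ)
  have hf_sub (x) : f x - 1 = ∑ i, I i x.1 * c i x.2 :=
    prod_char_indicator_sub_one hT ψ ((x.1 : ℝ), (x.2 : A))
  have hI (i) : Measurable (I i) :=
    (measurable_one.indicator measurableSet_Ioc).comp measurable_subtype_coe
  have hc (i) : Measurable (c i) := Measurable.of_discrete
  have hf : Measurable f := by
    rw [funext fun x => sub_eq_iff_eq_add.1 (hf_sub x)]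
    fun_prop
  have hfi : Integrable f ((volume.comap Subtype.val).prod ν) :=
    Integrable.of_bound hf.aestronglyMeasurable 1 <| ae_of_all _ fun x => by
      simp only [f, norm_prod, Circle.norm_coe, Finset.prod_const_one, le_refl]
  have hIi (i) : Integrable (I i) (volume.comap Subtype.val) :=
    Integrable.of_bound (hI i).aestronglyMeasurable 1 <| ae_of_all _ fun u =>
      (norm_indicator_le_norm_self _ _).trans_eq norm_one
  simp only [prod_char_jumpSum_sub a _ hT ψ]
  refine (integral_prod_poissonization _ hf hfi).trans (congrArg Complex.exp ?_)
  simp only [hf_sub]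
  rw [integral_finsetSum _ fun i _ => (hIi i).mul_prod Integrable.of_finite]
  refine Finset.sum_congr rfl fun i _ => ?_
  rw [integral_prod_mul, integral_indicator_Ioc_comap (hT₀.trans (hT (Fin.zero_le _)))
    (hT Fin.castSucc_lt_succ.le) ((hT (Fin.le_last _)).trans hTt)]

end Increments

/-! ### The path law -/

theorem forall_mem_iff_forall_sub_mem {A : Type*} [AddCommGroup A] {H : AddSubgroup A} {N : ℕ}
    {d : Fin (N + 1) → A} (h₀ : d 0 ∈ H) :
    (∀ i, d i ∈ H) ↔ ∀ i : Fin N, d i.succ - d i.castSucc ∈ H := by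
  refine ⟨fun h i => sub_mem (h _) (h _), fun h => Fin.induction h₀ fun i hi => ?_⟩
  simpa only [sub_add_cancel] using add_mem (h i) hi

theorem monotone_cons {α : Type*} [Preorder α] {N : ℕ} {a : α} {f : Fin N → α} (hf : Monotone f)
    (ha : ∀ i, a ≤ f i) : Monotone (Fin.cons a f : Fin (N + 1) → α) := by
  intro i j hij
  cases i using Fin.cases with
  | zero => exact Fin.cases le_rfl ha j
  | succ i =>
    obtain ⟨j, rfl⟩ := Fin.exists_succ_eq.2 (ne_of_gt ((Fin.succ_pos i).trans_le hij))
    exact hf (Fin.succ_le_succ_iff.1 hij)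

theorem measurableSet_cylinder {X : Type*} [TopologicalSpace X] [MeasurableSpace X] {t : ℝ} {N : ℕ}
    (τ : Fin N → Set.Icc (0 : ℝ) t) {J : Fin N → Set X} (hJ : ∀ i, MeasurableSet (J i)) :
    MeasurableSet {ω : skorokhod X t | ∀ i, ω.1 (τ i) ∈ J i} := by
  simp only [Set.ofPred_forall]
  exact MeasurableSet.iInter fun i =>
    ((measurable_pi_apply (τ i)).comp measurable_subtype_coe) (hJ i)

section PathLaw

variable {K : Type*} [Field K] [ValuativeRel K] [TopologicalSpace K]
  [IsNonarchimedeanLocalField K] {β : K} {S : Finset K} {n : ℕ} {χ : AddChar K Circle}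

theorem ite_gridRep_eq_sum_char (hβ : IsUniformizer β) (hS : IsResidueSystem S)
    (hχ : HasRankZero β χ) {N : ℕ} {x b : Fin (N + 1) → K} (hx : ∀ i, x i ∈ ballSubgroup β n)
    (hb : ∀ i, b i ∈ grid β S n) (h₀ : x 0 = b 0)
    [Decidable (∀ i, gridRep β S n (x i) = b i)] :
    (if ∀ i, gridRep β S n (x i) = b i then (1 : ℂ) else 0) =
      ∑ ξ ∈ Fintype.piFinset fun _ : Fin N => grid β S n,
        (∏ i, ((residueCard K : ℂ) ^ (2 * n))⁻¹ * (χ ((b i.succ - b i.castSucc) * ξ i) : ℂ)) *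
          ∏ i, (χ.mulShift (-ξ i) (x i.succ - x i.castSucc) : ℂ) := by
  classical
  let d (i : Fin (N + 1)) : K := b i - x i
  have hd (i : Fin (N + 1)) : d i ∈ ballSubgroup β n :=
    sub_mem (mem_ballSubgroup_of_mem_grid hβ hS (hb i)) (hx i)
  have h_visit : (∀ i, gridRep β S n (x i) = b i) ↔
      ∀ i : Fin N, d i.succ - d i.castSucc ∈ ballSubgroup β (-n) := by
    rw [← forall_mem_iff_forall_sub_mem (by simp [d, h₀])]
    exact forall_congr' fun i => (gridRep_eq_iff hβ hS (hx i) (hb i)).trans sub_mem_comm_iff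
  have h_step (i : Fin N) : (if d i.succ - d i.castSucc ∈ ballSubgroup β (-n) then (1 : ℂ) else 0) =
      ∑ η ∈ grid β S n, ((residueCard K : ℂ) ^ (2 * n))⁻¹ *
        (χ ((d i.succ - d i.castSucc) * η) : ℂ) := by
    have hq : (residueCard K : ℂ) ≠ 0 := Nat.cast_ne_zero.2 hS.residueCard_ne_zero
    rw [← Finset.mul_sum, sum_char_grid hβ hS hχ (sub_mem (hd _) (hd _)), mul_ite, mul_zero,
      inv_mul_cancel₀ (pow_ne_zero _ hq)]
  have h_split (i : Fin N) (η : K) : (χ ((d i.succ - d i.castSucc) * η) : ℂ) =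
      (χ ((b i.succ - b i.castSucc) * η) : ℂ) *
        (χ.mulShift (-η) (x i.succ - x i.castSucc) : ℂ) := by
    rw [AddChar.mulShift_apply, ← Circle.coe_mul, ← AddChar.map_add_eq_mul]
    congr 2
    ring
  calc (if ∀ i, gridRep β S n (x i) = b i then (1 : ℂ) else 0)
      = ∏ i : Fin N, if d i.succ - d i.castSucc ∈ ballSubgroup β (-n) then (1 : ℂ) else 0 := by
        rw [Finset.prod_ite_zero]
        simp only [h_visit, Finset.mem_univ, true_imp_iff, Finset.prod_const_one]
    _ = ∏ i : Fin N, ∑ η ∈ grid β S n, ((residueCard K : ℂ) ^ (2 * n))⁻¹ *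
          ((χ ((b i.succ - b i.castSucc) * η) : ℂ) *
            (χ.mulShift (-η) (x i.succ - x i.castSucc) : ℂ)) := by
        simp only [h_step, h_split]
    _ = _ := by
        rw [Finset.prod_univ_sum]
        simp only [← mul_assoc, Finset.prod_mul_distrib]

instance instT2Space : T2Space K := by
  let := IsTopologicalAddGroup.rightUniformSpace K
  have := isUniformAddGroup_of_addCommGroup (G := K)
  infer_instance

theorem inv_mul_density (α s : ℝ) (z : K) :
    ((residueCard K : ℂ) ^ n)⁻¹ * density β S n χ α s z =
      ∑ ξ ∈ grid β S n, ((residueCard K : ℂ) ^ (2 * n))⁻¹ * (χ (z * ξ) : ℂ) *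
        (Real.exp (-s * canonicalAbs ξ ^ α) : ℂ) := by
  rw [density, Finset.mul_sum, Finset.mul_sum]
  exact Finset.sum_congr rfl fun ξ _ => by ring

variable [MeasurableSpace K]

theorem IsPathLaw.eq {α t : ℝ} {a : K} {P Q : Measure (skorokhod K t)}
    (hP : IsPathLaw β S n χ α t a P) (hQ : IsPathLaw β S n χ α t a Q) : P = Q := by
  have := hP.isProbabilityMeasure
  have := hQ.isProbabilityMeasure
  have h_generate : (inferInstance : MeasurableSpace (skorokhod K t)) =
      .generateFrom (Set.preimage Subtype.val ''
        squareCylinders fun _ => {s | MeasurableSet s}) := by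
    rw [← MeasurableSpace.comap_generateFrom, generateFrom_squareCylinders]
    rfl
  refine ext_of_generate_finite _ h_generate ?_ ?_ (by simp)
  · exact (isPiSystem_squareCylinders (fun _ => MeasurableSpace.isPiSystem_measurableSet)
      fun _ => MeasurableSet.univ).comap _
  · rintro _ ⟨_, ⟨s, J, hJ, rfl⟩, rfl⟩
    have hJ (i) : MeasurableSet (J i) := by simpa using hJ i
    let τ := s.orderEmbOfFin rfl
    have h_cylinder : (Subtype.val ⁻¹' (s : Set (Set.Icc (0 : ℝ) t)).pi J : Set (skorokhod K t)) =
        {ω | ∀ i, ω.1 (τ i) ∈ J (τ i)} := by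
      ext ω
      simp only [Set.mem_preimage, Set.mem_ofPred_eq, ← s.range_orderEmbOfFin rfl, Set.mem_pi,
        Set.forall_mem_range, τ]
    rw [h_cylinder]
    refine (measureReal_eq_measureReal_iff (μ := P) (ν := Q)).1 (Complex.ofReal_injective ?_)
    rw [hP.cylinder _ _ τ.strictMono _ fun i => hJ _, hQ.cylinder _ _ τ.strictMono _ fun i => hJ _]

variable [BorelSpace K]

variable (β S n χ) in
/-- The Lévy measure of the process on the grid: it gives the mass `jumpRate β S n χ α z` to `z`. -/
def jumpMeasure (α : ℝ) : Measure (grid β S n) :=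
  Measure.count.withDensity fun z => ENNReal.ofReal (jumpRate β S n χ α z)

instance (α : ℝ) : IsFiniteMeasure (jumpMeasure β S n χ α) :=
  isFiniteMeasure_withDensity_ofReal Integrable.of_finite.2

theorem integral_jumpMeasure (hβ : IsUniformizer β) (hS : IsResidueSystem S)
    (hχ : HasRankZero β χ) {α : ℝ} (hα : 0 ≤ α) (f : K → ℂ) :
    ∫ z : grid β S n, f z ∂(jumpMeasure β S n χ α) =
      ∑ z ∈ grid β S n, (jumpRate β S n χ α z : ℂ) * f z := by
  rw [jumpMeasure, integral_withDensity_eq_integral_toReal_smul Measurable.of_discrete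
    (ae_of_all _ fun _ => ENNReal.ofReal_lt_top), integral_count,
    ← Finset.sum_coe_sort (grid β S n) fun z => (jumpRate β S n χ α z : ℂ) * f z]
  refine Finset.sum_congr rfl fun z _ => ?_
  rw [ENNReal.toReal_ofReal (jumpRate_nonneg hβ hS hχ hα z.2), Complex.real_smul]

theorem integral_char_sub_one_jumpMeasure (hβ : IsUniformizer β) (hS : IsResidueSystem S)
    (hχ : HasRankZero β χ) {α : ℝ} (hα : 0 < α) {ξ : K} (hξ : ξ ∈ grid β S n) :
    ∫ z : grid β S n, ((χ.mulShift (-ξ) z : ℂ) - 1) ∂(jumpMeasure β S n χ α) =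
      (-canonicalAbs ξ ^ α : ℝ) := by
  have h_char (η : K) (hη : η ∈ grid β S n) := sum_jumpRate_mul_char hβ hS hχ hα.le hη
  have h_zero := h_char 0 hS.zero_mem_grid
  simp only [zero_mul, neg_zero, AddChar.map_zero_eq_one, Circle.coe_one, mul_one] at h_zero
  rw [integral_jumpMeasure hβ hS hχ hα.le fun z => (χ.mulShift (-ξ) z : ℂ) - 1]
  simp only [AddChar.mulShift_apply, neg_mul, mul_sub, mul_one, Finset.sum_sub_distrib]
  rw [h_char ξ hξ, h_zero, ← Complex.ofReal_sub]
  simp [canonicalAbs, Real.zero_rpow hα.ne']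

theorem integral_prod_mulShift_jumpSum_sub (hβ : IsUniformizer β) (hS : IsResidueSystem S)
    (hχ : HasRankZero β χ) {α : ℝ} (hα : 0 < α) {t : ℝ} (a : K) {N : ℕ} {T : Fin (N + 1) → ℝ}
    (hT : Monotone T) (hT₀ : 0 ≤ T 0) (hTt : T (Fin.last N) ≤ t) {ξ : Fin N → K}
    (hξ : ∀ i, ξ i ∈ grid β S n) :
    ∫ p, ∏ i, (χ.mulShift (-ξ i) (jumpSum a p (T i.succ) - jumpSum a p (T i.castSucc)) : ℂ)
        ∂(jumpConfigurationLaw t (jumpMeasure β S n χ α)) =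
      Complex.exp (∑ i, (-(T i.succ - T i.castSucc) * canonicalAbs (ξ i) ^ α : ℝ)) := by
  rw [integral_prod_char_jumpSum_sub _ _ hT hT₀ hTt]
  congr 1
  refine Finset.sum_congr rfl fun i _ => ?_
  rw [integral_char_sub_one_jumpMeasure hβ hS hχ hα (hξ i), ← Complex.ofReal_mul, mul_neg, neg_mul]

theorem measureReal_gridRep_jumpSum (hβ : IsUniformizer β) (hS : IsResidueSystem S)
    (hχ : HasRankZero β χ) {α : ℝ} (hα : 0 < α) {t : ℝ} {N : ℕ} {T : Fin (N + 1) → ℝ}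
    (hT : Monotone T) (hT₀ : T 0 = 0) (hTt : T (Fin.last N) ≤ t) {b : Fin (N + 1) → K}
    (hb : ∀ i, b i ∈ grid β S n) :
    (((jumpConfigurationLaw t (jumpMeasure β S n χ α)).real
      {p | ∀ i, gridRep β S n (jumpSum (b 0) p (T i)) = b i} : ℝ) : ℂ) =
      ∏ i : Fin N, ((residueCard K : ℂ) ^ n)⁻¹ *
        density β S n χ α (T i.succ - T i.castSucc) (b i.succ - b i.castSucc) := by
  classical
  let A : Set (JumpConfiguration (grid β S n) t) :=
    {p | ∀ i, gridRep β S n (jumpSum (b 0) p (T i)) = b i}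
  let c (ξ : Fin N → K) : ℂ :=
    ∏ i, ((residueCard K : ℂ) ^ (2 * n))⁻¹ * (χ ((b i.succ - b i.castSucc) * ξ i) : ℂ)
  let X (ξ : Fin N → K) (p : JumpConfiguration (grid β S n) t) : ℂ :=
    ∏ i, (χ.mulShift (-ξ i) (jumpSum (b 0) p (T i.succ) - jumpSum (b 0) p (T i.castSucc)) : ℂ)
  have hA : MeasurableSet A := by
    simp only [A, Set.ofPred_forall]
    exact MeasurableSet.iInter fun i =>
      measurable_comp_jumpSum (gridRep β S n) (b 0) (T i) (measurableSet_singleton (b i))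
  have h_indicator (p) : ((A.indicator 1 p : ℝ) : ℂ) =
      ∑ ξ ∈ Fintype.piFinset fun _ => grid β S n, c ξ * X ξ p := by
    have hx (i) : jumpSum (b 0) p (T i) ∈ ballSubgroup β n :=
      jumpSum_mem (mem_ballSubgroup_of_mem_grid hβ hS (hb 0))
        (fun z => mem_ballSubgroup_of_mem_grid hβ hS) p _
    rw [← ite_gridRep_eq_sum_char hβ hS hχ hx hb (by rw [hT₀, jumpSum_zero]), Set.indicator_apply]
    simp only [A, Set.mem_ofPred_eq, Pi.one_apply, apply_ite Complex.ofReal, Complex.ofReal_one,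
      Complex.ofReal_zero]
  have hX {ξ} (hξ : ξ ∈ Fintype.piFinset fun _ => grid β S n) :=
    integral_prod_mulShift_jumpSum_sub hβ hS hχ hα (b 0) hT hT₀.ge hTt (Fintype.mem_piFinset.1 hξ)
  have hXi {ξ} (hξ) : Integrable (X ξ) (jumpConfigurationLaw t (jumpMeasure β S n χ α)) :=
    not_imp_comm.1 integral_undef ((hX hξ).trans_ne (Complex.exp_ne_zero _))
  rw [← integral_indicator_one hA, ← integral_complex_ofReal]
  simp only [h_indicator, inv_mul_density]
  rw [integral_finsetSum _ fun ξ hξ => (hXi hξ).const_mul _, Finset.prod_univ_sum]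
  refine Finset.sum_congr rfl fun ξ hξ => ?_
  rw [integral_const_mul, hX hξ, Finset.prod_mul_distrib, Complex.exp_sum]
  simp only [c, Complex.ofReal_exp]

variable (β S n χ) in
/-- The law on `D[0,t]` of the compound Poisson process with Lévy measure `jumpMeasure β S n χ α`
started at `a`, its values being reduced to the grid modulo `B_{-n}`. -/
def pathLaw (α t : ℝ) (a : K) : Measure (skorokhod K t) :=
  (jumpConfigurationLaw t (jumpMeasure β S n χ α)).map (jumpPath (gridRep β S n) a)

instance (α t : ℝ) (a : K) : IsProbabilityMeasure (pathLaw β S n χ α t a) :=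
  Measure.isProbabilityMeasure_map (measurable_jumpPath _ a).aemeasurable

theorem isPathLaw_pathLaw (hβ : IsUniformizer β) (hS : IsResidueSystem S)
    (hχ : HasRankZero β χ) {α : ℝ} (hα : 0 < α) {t : ℝ} (ht : 0 ≤ t) {a : K}
    (ha : a ∈ grid β S n) : IsPathLaw β S n χ α t a (pathLaw β S n χ α t a) := by
  classical
  refine ⟨inferInstance, fun N τ hτ J hJ => ?_⟩
  let X (p : JumpConfiguration (grid β S n) t) (i : Fin N) : K :=
    gridRep β S n (jumpSum a p (τ i))
  let T : Fin (N + 1) → ℝ := Fin.cons 0 fun j => (τ j : ℝ)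
  have hT : Monotone T := monotone_cons hτ.monotone fun i => (τ i).2.1
  have hTt (i) : T i ≤ t := Fin.cases ht (fun j => (τ j).2.2) i
  have h_point (b : Fin N → K) (hb : ∀ i, b i ∈ grid β S n) :
      (((jumpConfigurationLaw t (jumpMeasure β S n χ α)).real (X ⁻¹' {b}) : ℝ) : ℂ) =
        ∏ i : Fin N, ((residueCard K : ℂ) ^ n)⁻¹ * density β S n χ α
          (τ i - T i.castSucc) (b i - (Fin.cons a b : Fin (N + 1) → K) i.castSucc) := by
    have h := measureReal_gridRep_jumpSum (t := t) hβ hS hχ hα hT rfl (hTt _) (b := Fin.cons a b)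
      (Fin.cases ha hb)
    simp only [Fin.forall_fin_succ, Fin.cons_zero, Fin.cons_succ, T, jumpSum_zero,
      gridRep_of_mem_grid hβ hS ha, true_and] at h
    simpa only [Set.preimage, Set.mem_singleton_iff, funext_iff] using h
  have h_preimage : jumpPath (gridRep β S n) a ⁻¹' {ω : skorokhod K t | ∀ i, ω.1 (τ i) ∈ J i} =
      X ⁻¹' Fintype.piFinset fun i => (grid β S n).filter (· ∈ J i) := by
    ext p
    simp [X, jumpPath, gridRep_mem_grid hS]
  rw [pathLaw, map_measureReal_apply (measurable_jumpPath _ a) (measurableSet_cylinder τ hJ),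
    h_preimage, ← sum_measureReal_preimage_singleton, Complex.ofReal_sum]
  · refine Finset.sum_congr rfl fun b hb => ?_
    rw [h_point b fun i => (Finset.mem_filter.1 (Fintype.mem_piFinset.1 hb i)).1,
      Finset.prod_mul_distrib, Finset.prod_const, Finset.card_univ, Fintype.card_fin, inv_pow,
      ← pow_mul, mul_comm]
  · exact fun b _ => measurableSet_preimage (measurable_pi_lambda _ fun i =>
      measurable_comp_jumpSum _ a _) (measurableSet_singleton b)

theorem existsUnique_isPathLaw (hβ : IsUniformizer β) (hS : IsResidueSystem S)
    (hχ : HasRankZero β χ) {α : ℝ} (hα : 0 < α) {t : ℝ} (ht : 0 ≤ t) {a : K}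
    (ha : a ∈ grid β S n) : ∃! P : Measure (skorokhod K t), IsPathLaw β S n χ α t a P :=
  ⟨_, isPathLaw_pathLaw hβ hS hχ hα ht ha, fun _ hP => hP.eq (isPathLaw_pathLaw hβ hS hχ hα ht ha)⟩

theorem isPathLaw_pathMeasure (hβ : IsUniformizer β) (hS : IsResidueSystem S)
    (hχ : HasRankZero β χ) {α : ℝ} (hα : 0 < α) {t : ℝ} (ht : 0 ≤ t) {a : K}
    (ha : a ∈ grid β S n) : IsPathLaw β S n χ α t a (pathMeasure β S n χ α t a) := by
  have h := (existsUnique_isPathLaw hβ hS hχ hα ht ha).exists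
  rw [pathMeasure, dif_pos h]
  exact h.choose_spec

end PathLaw

/-! ### The Lie–Trotter product formula -/

section Trotter

variable {A : Type*} [NormedRing A]

theorem norm_pow_sub_pow_le [NormOneClass A] {a b : A} {r : ℝ} (hr : 1 ≤ r) (ha : ‖a‖ ≤ r)
    (hb : ‖b‖ ≤ r) (m : ℕ) : ‖a ^ m - b ^ m‖ ≤ m * r ^ m * ‖a - b‖ := by
  induction m with
  | zero => simp
  | succ m ih =>
    have hpow : ‖a ^ m‖ ≤ r ^ (m + 1) := calc
      ‖a ^ m‖ ≤ r ^ m := (norm_pow_le a m).trans (by gcongr)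
      _ ≤ r ^ (m + 1) := pow_le_pow_right₀ hr m.le_succ
    calc ‖a ^ (m + 1) - b ^ (m + 1)‖
        = ‖a ^ m * (a - b) + (a ^ m - b ^ m) * b‖ := by rw [pow_succ, pow_succ]; noncomm_ring
      _ ≤ ‖a ^ m‖ * ‖a - b‖ + ‖a ^ m - b ^ m‖ * ‖b‖ :=
          norm_add_le_of_le (norm_mul_le _ _) (norm_mul_le _ _)
      _ ≤ r ^ (m + 1) * ‖a - b‖ + (m * r ^ m * ‖a - b‖) * r := by gcongr
      _ = (m + 1 : ℕ) * r ^ (m + 1) * ‖a - b‖ := by push_cast; ring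

variable [NormedAlgebra ℂ A] [CompleteSpace A]

theorem norm_exp_le_exp_norm [NormOneClass A] (x : A) : ‖NormedSpace.exp x‖ ≤ Real.exp ‖x‖ := by
  have hsum : HasSum (fun k : ℕ => ‖x‖ ^ k / k.factorial) (Real.exp ‖x‖) := by
    simpa only [Real.exp_eq_exp_ℝ] using NormedSpace.expSeries_div_hasSum_exp ‖x‖
  rw [← (NormedSpace.exp_series_hasSum_exp' (𝕂 := ℂ) x).tsum_eq]
  refine tsum_of_norm_bounded hsum fun k => ?_
  rw [norm_smul, norm_inv, Complex.norm_natCast, div_eq_inv_mul]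
  gcongr
  exact norm_pow_le x k

theorem tendsto_natCast_smul_exp_mul_exp_sub_exp (X Y : A) :
    Tendsto (fun m : ℕ => (m : ℂ) • (NormedSpace.exp ((m : ℂ)⁻¹ • X) *
      NormedSpace.exp ((m : ℂ)⁻¹ • Y) - NormedSpace.exp ((m : ℂ)⁻¹ • (X + Y)))) atTop (𝓝 0) := by
  let _ : NormedAlgebra ℚ A := NormedAlgebra.restrictScalars ℚ ℂ A
  let F : ℂ → A := fun z =>
    NormedSpace.exp (z • X) * NormedSpace.exp (z • Y) - NormedSpace.exp (z • (X + Y))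
  have hF : HasDerivAt F 0 0 := by
    have hexp (Z : A) := hasDerivAt_exp_smul_const (𝕂 := ℂ) Z 0
    exact (((hexp X).mul (hexp Y)).sub (hexp (X + Y))).congr_deriv (by simp)
  have hinv : Tendsto (fun m : ℕ => (m : ℂ)⁻¹) atTop (𝓝[≠] 0) := by
    refine tendsto_nhdsWithin_iff.2 ⟨tendsto_inv_atTop_nhds_zero_nat, ?_⟩
    filter_upwards [eventually_ne_atTop 0] with m hm
    simpa using hm
  simpa [F, Function.comp_def] using (hasDerivAt_iff_tendsto_slope_zero.1 hF).comp hinv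

theorem tendsto_exp_mul_exp_pow [NormOneClass A] (X Y : A) :
    Tendsto (fun m : ℕ => (NormedSpace.exp ((m : ℂ)⁻¹ • X) * NormedSpace.exp ((m : ℂ)⁻¹ • Y)) ^ m)
      atTop (𝓝 (NormedSpace.exp (X + Y))) := by
  let _ : NormedAlgebra ℚ A := NormedAlgebra.restrictScalars ℚ ℂ A
  let a (m : ℕ) : A := NormedSpace.exp ((m : ℂ)⁻¹ • X) * NormedSpace.exp ((m : ℂ)⁻¹ • Y)
  let b (m : ℕ) : A := NormedSpace.exp ((m : ℂ)⁻¹ • (X + Y))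
  have hlim : Tendsto (fun m : ℕ => Real.exp (‖X‖ + ‖Y‖) * ‖(m : ℂ) • (a m - b m)‖) atTop
      (𝓝 0) := by
    simpa only [norm_zero, mul_zero] using
      (tendsto_natCast_smul_exp_mul_exp_sub_exp X Y).norm.const_mul (Real.exp (‖X‖ + ‖Y‖))
  refine tendsto_iff_norm_sub_tendsto_zero.2
    (squeeze_zero' (Eventually.of_forall fun _ => norm_nonneg _) ?_ hlim)
  filter_upwards [eventually_ne_atTop 0] with m hm
  have hm' : (m : ℂ) ≠ 0 := Nat.cast_ne_zero.2 hm
  have hb_pow : b m ^ m = NormedSpace.exp (X + Y) := by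
    rw [← NormedSpace.exp_nsmul, ← Nat.cast_smul_eq_nsmul ℂ, smul_inv_smul₀ hm']
  let r : ℝ := Real.exp ((‖X‖ + ‖Y‖) / m)
  have hr_pow : r ^ m = Real.exp (‖X‖ + ‖Y‖) := by
    rw [← Real.exp_nat_mul, mul_div_cancel₀ _ (Nat.cast_ne_zero.2 hm)]
  have hnorm (Z : A) : ‖(m : ℂ)⁻¹ • Z‖ = ‖Z‖ / m := by
    rw [norm_smul, norm_inv, Complex.norm_natCast, div_eq_inv_mul]
  have ha : ‖a m‖ ≤ r := by
    simp only [r, add_div, Real.exp_add, ← hnorm]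
    exact norm_mul_le_of_le (norm_exp_le_exp_norm _) (norm_exp_le_exp_norm _)
  have hb : ‖b m‖ ≤ r := by
    refine (norm_exp_le_exp_norm _).trans (Real.exp_le_exp.2 ?_)
    rw [hnorm]
    gcongr
    exact norm_add_le X Y
  calc ‖a m ^ m - NormedSpace.exp (X + Y)‖ = ‖a m ^ m - b m ^ m‖ := by rw [hb_pow]
    _ ≤ m * r ^ m * ‖a m - b m‖ := norm_pow_sub_pow_le (Real.one_le_exp (by positivity)) ha hb m
    _ = Real.exp (‖X‖ + ‖Y‖) * ‖(m : ℂ) • (a m - b m)‖ := by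
        rw [hr_pow, norm_smul, Complex.norm_natCast]; ring

end Trotter

/-! ### Functions of diagonalized operators -/

section FunctionalCalculus

variable {E A : Type*} [Finite E] [CStarAlgebra A]

theorem continuous_starAlgHom_pi (φ : (E → ℂ) →⋆ₐ[ℂ] A) : Continuous φ :=
  LinearMap.continuous_of_finiteDimensional φ.toAlgHom.toLinearMap

theorem starAlgHom_pi_rpow [PartialOrder A] [StarOrderedRing A] (φ : (E → ℂ) →⋆ₐ[ℂ] A)
    {g : E → ℝ} (hg : ∀ x, 0 ≤ g x) {α : ℝ} (hα : 0 < α) :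
    φ (fun x => (g x : ℂ)) ^ α = φ fun x => ((g x ^ α : ℝ) : ℂ) := by
  have := Fintype.ofFinite E
  open scoped ComplexOrder in
  have hg0 : (0 : E → ℂ) ≤ fun x => (g x : ℂ) := fun x => by simpa using hg x
  have hsa : IsSelfAdjoint fun x => (g x : ℂ) := funext fun x => Complex.conj_ofReal (g x)
  have : ContinuousFunctionalCalculus ℝ (E → ℂ) IsSelfAdjoint :=
    IsSelfAdjoint.instContinuousFunctionalCalculus
  have hpow : Continuous fun x : ℝ => x ^ α := Real.continuous_rpow_const hα.le
  calc φ (fun x => (g x : ℂ)) ^ α = cfc (fun x : ℝ => x ^ α) (φ fun x => (g x : ℂ)) :=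
        CFC.rpow_eq_cfc_real (map_nonneg φ hg0)
    _ = φ (cfc (fun x : ℝ => x ^ α) fun x => (g x : ℂ)) :=
        (φ.map_cfc (fun x : ℝ => x ^ α) _ hpow.continuousOn (continuous_starAlgHom_pi φ) hsa
          (hsa.map φ)).symm
    _ = φ fun x => ((g x ^ α : ℝ) : ℂ) := by
        rw [cfc_map_pi (S := ℂ) (fun x : ℝ => x ^ α) _ hpow.continuousOn hsa
          fun x => isSelfAdjoint_iff.2 (Complex.conj_ofReal (g x))]
        exact congrArg φ (funext fun x => cfc_algebraMap (A := ℂ) (g x) fun x : ℝ => x ^ α)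

theorem exp_starAlgHom_pi (φ : (E → ℂ) →⋆ₐ[ℂ] A) (g : E → ℂ) :
    NormedSpace.exp (φ g) = φ fun x => Complex.exp (g x) := by
  have := Fintype.ofFinite E
  let _ : NormedAlgebra ℚ A := NormedAlgebra.restrictScalars ℚ ℂ A
  rw [← NormedSpace.map_exp φ (continuous_starAlgHom_pi φ), Pi.exp_def, Complex.exp_eq_exp_ℂ]

end FunctionalCalculus

/-! ### The semigroups of the finite operators -/

section Operators

variable {K : Type*} [Field K] {β : K} {S : Finset K} {n : ℕ}

theorem matrixOp_apply (A : Matrix (grid β S n) (grid β S n) ℂ) (f : GridL2 β S n)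
    (x : grid β S n) : matrixOp β S n A f x = ∑ y, A x y * f y := rfl

theorem matrixOp_mul (A B : Matrix (grid β S n) (grid β S n) ℂ) :
    matrixOp β S n A * matrixOp β S n B = matrixOp β S n (A * B) := by
  classical exact (map_mul Matrix.toEuclideanCLM A B).symm

theorem star_matrixOp (A : Matrix (grid β S n) (grid β S n) ℂ) :
    star (matrixOp β S n A) = matrixOp β S n A.conjTranspose := by
  classical exact (map_star Matrix.toEuclideanCLM A).symm

open Classical in
theorem matrixOp_pow (A : Matrix (grid β S n) (grid β S n) ℂ) (m : ℕ) :
    matrixOp β S n A ^ m = matrixOp β S n (A ^ m) :=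
  (map_pow Matrix.toEuclideanCLM A m).symm

theorem matrixOp_mul_mulOp (A : Matrix (grid β S n) (grid β S n) ℂ) (g : K → ℝ) :
    matrixOp β S n A * mulOp β S n g = matrixOp β S n (Matrix.of fun x y => A x y * (g y : ℂ)) := by
  classical
  rw [mulOp, matrixOp_mul]
  congr 1
  ext x y
  exact Matrix.mul_diagonal _ _ _ _

open Classical in
variable (β S n) in
/-- The representation of complex functions on `X_n` as multiplication operators on `L²(X_n)`. -/
def multiplicationHom : (grid β S n → ℂ) →⋆ₐ[ℂ] (GridL2 β S n →L[ℂ] GridL2 β S n) where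
  toFun g := matrixOp β S n (Matrix.diagonal g)
  map_one' := by rw [Matrix.diagonal_one']; exact map_one Matrix.toEuclideanCLM
  map_mul' f g := by rw [matrixOp_mul, Matrix.diagonal_mul_diagonal]; rfl
  map_zero' := by rw [Matrix.diagonal_zero']; exact map_zero Matrix.toEuclideanCLM
  map_add' f g := (congrArg (matrixOp β S n) (Matrix.diagonal_add f g).symm).trans
    (map_add Matrix.toEuclideanCLM _ _)
  commutes' c := by
    rw [← AlgHomClass.commutes (Matrix.toEuclideanCLM (n := grid β S n) (𝕜 := ℂ)) c,
      Matrix.algebraMap_eq_diagonal]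
    rfl
  map_star' g := by rw [star_matrixOp, Matrix.diagonal_conjTranspose]

theorem multiplicationHom_ofReal (g : K → ℝ) :
    multiplicationHom β S n (fun x => (g x : ℂ)) = mulOp β S n g := rfl

theorem exp_neg_smul_mulOp (g : K → ℝ) (s : ℝ) :
    NormedSpace.exp (-(s : ℂ) • mulOp β S n g) = mulOp β S n fun x => Real.exp (-s * g x) := by
  rw [← multiplicationHom_ofReal, ← map_smul, exp_starAlgHom_pi, ← multiplicationHom_ofReal]
  congr 1
  ext x
  simp

end Operators

section Fourier

variable {K : Type*} [Field K] [ValuativeRel K] [TopologicalSpace K]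
  [IsNonarchimedeanLocalField K] {β : K} {S : Finset K} {n : ℕ} {χ : AddChar K Circle}

theorem star_fourierOp : star (fourierOp β S n χ) = fourierInvOp β S n χ := by
  rw [fourierOp, star_matrixOp, fourierInvOp]
  congr 1
  ext x y
  simp only [Matrix.conjTranspose_apply, Matrix.of_apply, star_mul', star_inv₀, star_pow,
    star_natCast]
  rw [AddChar.map_neg_eq_inv, Circle.coe_inv_eq_conj, starRingEnd_apply, star_star,
    mul_comm (y : K)]

theorem fourierInvOp_mul_mulOp_mul_fourierOp (g : K → ℝ) :
    fourierInvOp β S n χ * mulOp β S n g * fourierOp β S n χ =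
      matrixOp β S n (Matrix.of fun x y => ∑ ξ ∈ grid β S n,
        ((residueCard K : ℂ) ^ (2 * n))⁻¹ * (χ (((x : K) - y) * ξ) : ℂ) * (g ξ : ℂ)) := by
  rw [fourierInvOp, fourierOp, matrixOp_mul_mulOp, matrixOp_mul]
  congr 1
  ext x y
  rw [Matrix.mul_apply, Matrix.of_apply, ← Finset.sum_coe_sort (grid β S n)]
  refine Finset.sum_congr rfl fun ξ _ => ?_
  have hsub : ((x : K) - y) * ξ = (x : K) * ξ + -((ξ : K) * y) := by ring
  rw [Matrix.of_apply, Matrix.of_apply, Matrix.of_apply, hsub, AddChar.map_add_eq_mul,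
    Circle.coe_mul, two_mul, pow_add, mul_inv]
  ring

theorem fourierInvOp_mul_fourierOp (hβ : IsUniformizer β) (hS : IsResidueSystem S)
    (hχ : HasRankZero β χ) : fourierInvOp β S n χ * fourierOp β S n χ = 1 := by
  classical
  have hq : (residueCard K : ℂ) ≠ 0 := Nat.cast_ne_zero.2 hS.residueCard_ne_zero
  have hone : mulOp β S n (fun _ => 1) = 1 := by
    rw [← multiplicationHom_ofReal, ← map_one (multiplicationHom β S n)]
    simp only [Complex.ofReal_one, Pi.one_def]
  calc fourierInvOp β S n χ * fourierOp β S n χ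
      = fourierInvOp β S n χ * mulOp β S n (fun _ => 1) * fourierOp β S n χ := by
        rw [hone, mul_one]
    _ = mulOp β S n (fun _ => 1) := by
        rw [fourierInvOp_mul_mulOp_mul_fourierOp, mulOp]
        congr 1
        ext x y
        rw [Matrix.of_apply, Matrix.diagonal_apply]
        simp only [Complex.ofReal_one, mul_one, ← Finset.mul_sum,
          sum_char_grid_sub hβ hS hχ x.2 y.2, SetLike.coe_eq_coe, mul_ite, mul_zero,
          inv_mul_cancel₀ (pow_ne_zero _ hq)]
    _ = 1 := hone

theorem fourierOp_mul_fourierInvOp (hβ : IsUniformizer β) (hS : IsResidueSystem S)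
    (hχ : HasRankZero β χ) : fourierOp β S n χ * fourierInvOp β S n χ = 1 := by
  have h : (fourierInvOp β S n χ : GridL2 β S n →ₗ[ℂ] GridL2 β S n) *
      (fourierOp β S n χ : GridL2 β S n →ₗ[ℂ] GridL2 β S n) = 1 :=
    congr_arg ContinuousLinearMap.toLinearMap (fourierInvOp_mul_fourierOp hβ hS hχ)
  exact ContinuousLinearMap.coe_injective (mul_eq_one_comm.1 h)

theorem exp_neg_smul_momentumOp_rpow (hβ : IsUniformizer β) (hS : IsResidueSystem S)
    (hχ : HasRankZero β χ) {α : ℝ} (hα : 0 < α) (s : ℝ) :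
    NormedSpace.exp (-(s : ℂ) • momentumOp β S n χ ^ α) =
      matrixOp β S n (Matrix.of fun x y =>
        ((residueCard K : ℂ) ^ n)⁻¹ * density β S n χ α s ((x : K) - y)) := by
  let U : unitary (GridL2 β S n →L[ℂ] GridL2 β S n) := ⟨fourierInvOp β S n χ, by
    rw [Unitary.mem_iff, ← star_fourierOp, star_star, star_fourierOp]
    exact ⟨fourierOp_mul_fourierInvOp hβ hS hχ, fourierInvOp_mul_fourierOp hβ hS hχ⟩⟩
  let φ : (grid β S n → ℂ) →⋆ₐ[ℂ] (GridL2 β S n →L[ℂ] GridL2 β S n) :=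
    (Unitary.conjStarAlgAut ℂ _ U : _ →⋆ₐ[ℂ] _).comp (multiplicationHom β S n)
  have hφ (g : K → ℝ) : φ (fun x => (g x : ℂ)) =
      fourierInvOp β S n χ * mulOp β S n g * fourierOp β S n χ := by
    rw [← star_star (fourierOp β S n χ), star_fourierOp]
    rfl
  calc NormedSpace.exp (-(s : ℂ) • momentumOp β S n χ ^ α)
      = NormedSpace.exp (-(s : ℂ) • φ (fun x => (canonicalAbs (x : K) : ℂ)) ^ α) := by
        rw [hφ canonicalAbs, momentumOp]
    _ = φ fun x => ((Real.exp (-s * canonicalAbs (x : K) ^ α) : ℝ) : ℂ) := by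
        rw [starAlgHom_pi_rpow φ (fun _ => canonicalAbs_nonneg _) hα, ← map_smul,
          exp_starAlgHom_pi]
        simp
    _ = _ := by
        rw [hφ fun x => Real.exp (-s * canonicalAbs x ^ α), fourierInvOp_mul_mulOp_mul_fourierOp]
        simp only [inv_mul_density]

theorem gridRep_neg_gridRep_neg (hβ : IsUniformizer β) (hS : IsResidueSystem S) {ξ : K}
    (hξ : ξ ∈ grid β S n) : gridRep β S n (-gridRep β S n (-ξ)) = ξ := by
  have hξ' := neg_mem (mem_ballSubgroup_of_mem_grid hβ hS hξ)
  have hrep := mem_ballSubgroup_of_mem_grid hβ hS (gridRep_mem_grid hS (-ξ) (n := n) (β := β))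
  rw [gridRep_eq_iff hβ hS (neg_mem hrep) hξ, neg_sub_left, neg_add']
  exact sub_gridRep_mem hβ hS hξ'

theorem canonicalAbs_gridRep_neg (hβ : IsUniformizer β) (hS : IsResidueSystem S) {ξ : K}
    (hξ : ξ ∈ grid β S n) : canonicalAbs (gridRep β S n (-ξ)) = canonicalAbs ξ := by
  have hle {η : K} (hη : η ∈ grid β S n) :
      canonicalAbs (gridRep β S n (-η)) ≤ canonicalAbs η := by
    refine canonicalAbs_le_of_valuation_le ?_
    rw [← Valuation.map_neg _ η]
    exact valuation_gridRep_le hβ hS (neg_mem (mem_ballSubgroup_of_mem_grid hβ hS hη))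
  refine (hle hξ).antisymm ?_
  simpa only [gridRep_neg_gridRep_neg hβ hS hξ] using
    hle (gridRep_mem_grid hS (-ξ) (n := n) (β := β))

theorem density_neg (hβ : IsUniformizer β) (hS : IsResidueSystem S) (hχ : HasRankZero β χ)
    (α s : ℝ) {x : K} (hx : x ∈ ballSubgroup β n) :
    density β S n χ α s (-x) = density β S n χ α s x := by
  unfold density
  congr 1
  refine Finset.sum_nbij' (fun ξ => gridRep β S n (-ξ)) (fun ξ => gridRep β S n (-ξ))
    (fun _ _ => gridRep_mem_grid hS _) (fun _ _ => gridRep_mem_grid hS _)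
    (fun _ => gridRep_neg_gridRep_neg hβ hS) (fun _ => gridRep_neg_gridRep_neg hβ hS)
    fun ξ hξ => ?_
  rw [canonicalAbs_gridRep_neg hβ hS hξ, map_mul_gridRep hβ hS hχ hx
    (neg_mem (mem_ballSubgroup_of_mem_grid hβ hS hξ)), neg_mul x, mul_neg x]

open Classical in
theorem tendsto_transfer_pow_apply (hβ : IsUniformizer β) (hS : IsResidueSystem S)
    (hχ : HasRankZero β χ) {α : ℝ} (hα : 0 < α) (v : K → ℝ) (t : ℝ) (f : GridL2 β S n)
    (x : grid β S n) :
    Tendsto (fun m : ℕ => ∑ y, ((Matrix.of fun x y : grid β S n => ((residueCard K : ℂ) ^ n)⁻¹ *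
        density β S n χ α (t / m) ((y : K) - x) * (Real.exp (-(t / m) * v y) : ℂ)) ^ m) x y * f y)
      atTop (𝓝 (NormedSpace.exp (-(t : ℂ) • hamiltonian β S n χ α v) f x)) := by
  have : Nonempty (grid β S n) := ⟨⟨0, hS.zero_mem_grid⟩⟩
  have heval : Continuous fun T : GridL2 β S n →L[ℂ] GridL2 β S n => T f x :=
    (PiLp.continuous_apply 2 _ x).comp (by fun_prop)
  have htrotter := tendsto_exp_mul_exp_pow (-(t : ℂ) • momentumOp β S n χ ^ α)
    (-(t : ℂ) • mulOp β S n v)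
  have hsum : -(t : ℂ) • momentumOp β S n χ ^ α + -(t : ℂ) • mulOp β S n v =
      -(t : ℂ) • hamiltonian β S n χ α v := by
    rw [hamiltonian, smul_add]
  rw [hsum] at htrotter
  refine ((heval.tendsto _).comp htrotter).congr fun m => ?_
  have hsmul (A : GridL2 β S n →L[ℂ] GridL2 β S n) :
      (m : ℂ)⁻¹ • -(t : ℂ) • A = -((t / m : ℝ) : ℂ) • A := by
    rw [smul_smul]
    congr 1
    push_cast
    ring
  have hsymm (x y : grid β S n) :
      density β S n χ α (t / m) ((x : K) - y) = density β S n χ α (t / m) ((y : K) - x) := by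
    rw [← neg_sub, density_neg hβ hS hχ α _ (sub_mem (mem_ballSubgroup_of_mem_grid hβ hS y.2)
      (mem_ballSubgroup_of_mem_grid hβ hS x.2))]
  rw [Function.comp_apply, hsmul, hsmul, exp_neg_smul_momentumOp_rpow hβ hS hχ hα,
    exp_neg_smul_mulOp, matrixOp_mul_mulOp, matrixOp_pow, matrixOp_apply]
  simp only [Matrix.of_apply, hsymm]

end Fourier

/-! ### Path sums and Riemann sums -/

theorem matrix_pow_apply_eq_sum_paths {E R : Type*} [Fintype E] [DecidableEq E] [CommSemiring R]
    (M : Matrix E E R) (m : ℕ) (x y : E) :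
    (M ^ m) x y = ∑ b : Fin m → E,
      if (Fin.cons x b : Fin (m + 1) → E) (Fin.last m) = y then
        ∏ i : Fin m, M ((Fin.cons x b : Fin (m + 1) → E) i.castSucc) (b i) else 0 := by
  induction m generalizing x with
  | zero => simp [Matrix.one_apply]
  | succ m ih =>
    rw [pow_succ', Matrix.mul_apply, ← (Fin.consEquiv fun _ => E).sum_comp,
      Fintype.sum_prod_type]
    refine Finset.sum_congr rfl fun z _ => ?_
    rw [ih, Finset.mul_sum]
    refine Finset.sum_congr rfl fun b _ => ?_
    simp only [Fin.consEquiv_apply, Fin.prod_univ_succ, ← Fin.succ_last, Fin.cons_succ,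
      Fin.castSucc_zero, Fin.cons_zero, ← Fin.succ_castSucc, mul_ite, mul_zero]

section Riemann

variable {E : Type*} [NormedAddCommGroup E] [NormedSpace ℝ E] [CompleteSpace E]

theorem integral_comp_floor_div (c : ℕ → E) {d : ℝ} (hd : 0 < d) (m : ℕ) :
    ∫ s in (0 : ℝ)..m * d, c ⌊s / d⌋₊ = d • ∑ i ∈ Finset.range m, c i := by
  have hle (i : ℕ) : i * d ≤ (i + 1 : ℕ) * d := by gcongr; exact i.le_succ
  have hfloor (i : ℕ) : Set.EqOn (fun s => c ⌊s / d⌋₊) (fun _ => c i)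
      (Set.Ioo (i * d) ((i + 1 : ℕ) * d)) := fun s hs => by
    have hs' : ⌊s / d⌋₊ = i := by
      rw [Nat.floor_eq_iff (div_nonneg ((by positivity : 0 ≤ i * d).trans hs.1.le) hd.le),
        le_div_iff₀ hd, div_lt_iff₀ hd]
      exact ⟨hs.1.le, by exact_mod_cast hs.2⟩
    simp only [hs']
  have hint (i : ℕ) : IntervalIntegrable (fun s => c ⌊s / d⌋₊) volume (i * d) ((i + 1 : ℕ) * d) :=
    (intervalIntegrable_const (c := c i)).congr_uIoo (by
      rw [Set.uIoo_of_le (hle i)]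
      exact (hfloor i).symm)
  have hsum := intervalIntegral.sum_integral_adjacent_intervals (a := fun i : ℕ => i * d)
    (n := m) fun i _ => hint i
  simp only [Nat.cast_zero, zero_mul] at hsum
  rw [← hsum, Finset.smul_sum]
  refine Finset.sum_congr rfl fun i _ => ?_
  rw [intervalIntegral.integral_congr_Ioo_of_le (hle i) (hfloor i),
    intervalIntegral.integral_const]
  congr 1
  push_cast
  ring

theorem tendsto_floor_div_add_one_mul {t s : ℝ} (ht : 0 < t) (hs : 0 ≤ s) :
    Tendsto (fun m : ℕ => (⌊s / (t / m)⌋₊ + 1 : ℝ) * (t / m)) atTop (𝓝[>] s) := by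
  have hstep {m : ℕ} (hm : 0 < m) : 0 < t / m := div_pos ht (Nat.cast_pos.2 hm)
  have hlower : ∀ᶠ m : ℕ in atTop, s < (⌊s / (t / m)⌋₊ + 1 : ℝ) * (t / m) := by
    filter_upwards [eventually_gt_atTop 0] with m hm
    rw [← div_lt_iff₀ (hstep hm)]
    exact Nat.lt_floor_add_one _
  have hupper : ∀ᶠ m : ℕ in atTop, (⌊s / (t / m)⌋₊ + 1 : ℝ) * (t / m) ≤ s + t / m := by
    filter_upwards [eventually_gt_atTop 0] with m hm
    rw [add_mul, one_mul]
    gcongr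
    exact (le_div_iff₀ (hstep hm)).1 (Nat.floor_le (div_nonneg hs (hstep hm).le))
  have hlimit : Tendsto (fun m : ℕ => s + t / m) atTop (𝓝 s) := by
    simpa only [add_zero] using (tendsto_const_div_atTop_nhds_zero_nat t).const_add s
  exact tendsto_nhdsWithin_iff.2 ⟨tendsto_of_tendsto_of_tendsto_of_le_of_le' tendsto_const_nhds
    hlimit (hlower.mono fun _ => le_of_lt) hupper, hlower⟩

theorem tendsto_riemann_sum {t : ℝ} (ht : 0 < t) {h : ℝ → E} {C : ℝ} (hC : ∀ s, ‖h s‖ ≤ C)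
    (hright : ∀ s ∈ Set.Ico 0 t, Tendsto h (𝓝[>] s) (𝓝 (h s))) :
    Tendsto (fun m : ℕ => (t / m) • ∑ i ∈ Finset.range m, h ((i + 1) * (t / m))) atTop
      (𝓝 (∫ s in (0 : ℝ)..t, h s)) := by
  have hlimit : Tendsto (fun m : ℕ => ∫ s in (0 : ℝ)..t, h ((⌊s / (t / m)⌋₊ + 1) * (t / m))) atTop
      (𝓝 (∫ s in (0 : ℝ)..t, h s)) := by
    refine intervalIntegral.tendsto_integral_filter_of_dominated_convergence (fun _ => C)
      (.of_forall fun m => ?_) (.of_forall fun m => .of_forall fun s _ => hC _)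
      intervalIntegrable_const ?_
    · have hdiscrete : StronglyMeasurable fun k : ℕ => h ((k + 1) * (t / m)) := .of_discrete
      exact (hdiscrete.comp_measurable (measurable_id.div_const _).nat_floor).aestronglyMeasurable
    · filter_upwards [Measure.ae_ne volume t] with s hst hs
      rw [Set.uIoc_of_le ht.le] at hs
      exact (hright s ⟨hs.1.le, hs.2.lt_of_ne hst⟩).comp (tendsto_floor_div_add_one_mul ht hs.1.le)
  refine hlimit.congr' ?_
  filter_upwards [eventually_gt_atTop 0] with m hm
  have hm' : (0 : ℝ) < m := Nat.cast_pos.2 hm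
  rw [← integral_comp_floor_div (fun k => h ((k + 1) * (t / m))) (div_pos ht hm') m,
    mul_div_cancel₀ t hm'.ne']

end Riemann

section Paths

variable {K : Type*} [Field K] [ValuativeRel K] {β : K} {S : Finset K} {n : ℕ}

theorem norm_discretize_le (v : K → ℝ) (x : K) :
    ‖discretize β S n v x‖ ≤ ∑ y ∈ grid β S n, ‖v y‖ :=
  (norm_sum_le _ _).trans (Finset.sum_le_sum fun _ _ => norm_indicator_le_norm_self _ _)

variable [TopologicalSpace K] [IsNonarchimedeanLocalField K]

theorem discretize_of_mem_grid (hβ : IsUniformizer β) (hS : IsResidueSystem S) (v : K → ℝ) {x : K}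
    (hx : x ∈ grid β S n) : discretize β S n v x = v x := by
  rw [discretize, Finset.sum_eq_single_of_mem x hx]
  · exact Set.indicator_of_mem (by
      rw [Set.mem_ofPred_eq, sub_self]
      exact (ballSubgroup β (-(n : ℤ))).zero_mem) _
  · refine fun y hy hne => Set.indicator_of_notMem (fun h => hne ?_) _
    exact (eq_of_mem_grid_of_sub_mem hβ hS hx hy h).symm

theorem continuous_discretize (v : K → ℝ) : Continuous (discretize β S n v) := by
  refine continuous_finsetSum _ fun y _ => ?_
  have hclopen : IsClopen {w : K | w - y ∈ ball β (-(n : ℤ))} :=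
    (isClopen_ballSubgroup β (-(n : ℤ))).preimage (continuous_id.sub continuous_const)
  exact continuous_const.indicator fun x hx => by simp [hclopen.frontier_eq] at hx

/-- The division points `(i + 1) t / m`, `i < m`, of `[0,t]` into `m` intervals, without the left
endpoint `0`. -/
def gridTime {t : ℝ} (ht : 0 ≤ t) {m : ℕ} (i : Fin m) : Set.Icc (0 : ℝ) t :=
  ⟨((i : ℕ) + 1) * (t / m), by positivity, by
    have hm : (m : ℝ) ≠ 0 := Nat.cast_ne_zero.2 i.pos.ne'
    calc ((i : ℕ) + 1 : ℝ) * (t / m) ≤ m * (t / m) := by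
          gcongr
          exact_mod_cast i.2
      _ = t := mul_div_cancel₀ t hm⟩

theorem strictMono_gridTime {t : ℝ} (ht : 0 < t) (m : ℕ) :
    StrictMono (gridTime ht.le : Fin m → Set.Icc (0 : ℝ) t) := fun i j hij => by
  have hm : (0 : ℝ) < m := Nat.cast_pos.2 i.pos
  have hij' : ((i : ℕ) : ℝ) < (j : ℕ) := Nat.cast_lt.2 hij
  rw [← Subtype.coe_lt_coe, gridTime, gridTime]
  dsimp only
  gcongr

theorem gridTime_last {t : ℝ} (ht : 0 ≤ t) (m : ℕ) :
    gridTime ht (Fin.last m) = ⟨t, ht, le_rfl⟩ := by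
  ext
  simp only [gridTime, Fin.val_last]
  push_cast
  field_simp

theorem gridTime_sub {t : ℝ} (ht : 0 ≤ t) {m : ℕ} (i : Fin m) :
    (gridTime ht i : ℝ) - (Fin.cons 0 (fun j => (gridTime ht j : ℝ)) : Fin (m + 1) → ℝ)
      i.castSucc = t / m := by
  obtain ⟨k, rfl⟩ := Nat.exists_eq_add_one.2 i.pos
  refine Fin.cases ?_ (fun j => ?_) i
  · simp [gridTime]
  · rw [← Fin.succ_castSucc, Fin.cons_succ]
    simp only [gridTime, Fin.val_succ, Fin.val_castSucc, Nat.cast_add, Nat.cast_one]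
    ring

theorem tendsto_projIcc_nhdsGT {a b : ℝ} (hab : a ≤ b) {s : ℝ} (hs : s ∈ Set.Ico a b) :
    Tendsto (Set.projIcc a b hab) (𝓝[>] s) (𝓝[>] ⟨s, Set.Ico_subset_Icc_self hs⟩) := by
  have hs' := Set.Ico_subset_Icc_self hs
  refine tendsto_nhdsWithin_iff.2 ⟨?_, ?_⟩
  · rw [← Set.projIcc_of_mem hab hs']
    exact continuous_projIcc.continuousWithinAt
  · filter_upwards [Ioo_mem_nhdsGT hs.2] with r hr
    rw [Set.projIcc_of_mem hab ⟨hs.1.trans hr.1.le, hr.2.le⟩]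
    exact hr.1

theorem tendsto_riemann_sum_path (v : K → ℝ) {t : ℝ} (ht : 0 < t) (ω : skorokhod K t) :
    Tendsto (fun m : ℕ => ∑ i : Fin m, t / m * discretize β S n v (ω.1 (gridTime ht.le i))) atTop
      (𝓝 (∫ s : Set.Icc (0 : ℝ) t, discretize β S n v (ω.1 s) ∂(volume.comap Subtype.val))) := by
  let g : Set.Icc (0 : ℝ) t → ℝ := fun s => discretize β S n v (ω.1 s)
  have hint : ∫ s, g s ∂(volume.comap Subtype.val) =
      ∫ s in (0 : ℝ)..t, Set.IccExtend ht.le g s := by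
    rw [intervalIntegral.integral_of_le ht.le, ← integral_Icc_eq_integral_Ioc,
      ← integral_subtype_comap measurableSet_Icc]
    simp only [Set.IccExtend_val]
  rw [hint]
  refine (tendsto_riemann_sum ht (h := Set.IccExtend ht.le g)
    (fun s => norm_discretize_le v _) fun s hs => ?_).congr fun m => ?_
  · have hs' := Set.Ico_subset_Icc_self hs
    rw [Set.IccExtend_of_mem _ _ hs']
    exact ((continuous_discretize v).tendsto _).comp
      ((ω.2.1 ⟨s, hs'⟩ hs.2).comp (tendsto_projIcc_nhdsGT ht.le hs))
  · rw [smul_eq_mul, Finset.mul_sum, ← Fin.sum_univ_eq_sum_range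
      fun i : ℕ => t / m * Set.IccExtend ht.le g ((i + 1) * (t / m))]
    refine Finset.sum_congr rfl fun i _ => ?_
    exact congrArg (t / m * ·) (Set.IccExtend_of_mem ht.le g (gridTime ht.le i).2)

end Paths

/-! ### The Feynman–Kac formula -/

section FiniteDimensional

variable {K : Type*} [Field K] [ValuativeRel K] [TopologicalSpace K]
  [IsNonarchimedeanLocalField K] {β : K} {S : Finset K} {n : ℕ} {χ : AddChar K Circle}
  [MeasurableSpace K] [MeasurableSingletonClass K] {α t : ℝ} {a : K} {P : Measure (skorokhod K t)}
  {N : ℕ} {τ : Fin N → Set.Icc (0 : ℝ) t}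

theorem IsPathLaw.real_eval_eq (hP : IsPathLaw β S n χ α t a P) (hτ : StrictMono τ)
    {b : Fin N → K} (hb : ∀ i, b i ∈ grid β S n) :
    (P.real {ω | ∀ i, ω.1 (τ i) = b i} : ℂ) =
      (∏ i : Fin N, density β S n χ α
        ((τ i : ℝ) - (Fin.cons 0 (fun j => (τ j : ℝ)) : Fin (N + 1) → ℝ) i.castSucc)
        (b i - (Fin.cons a b : Fin (N + 1) → K) i.castSucc)) *
      ((residueCard K : ℂ) ^ (n * N))⁻¹ := by
  classical
  have hcylinder := hP.cylinder N τ hτ (fun i => {b i}) fun i => measurableSet_singleton _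
  simp only [Set.mem_singleton_iff] at hcylinder
  have hfilter : (fun i => (grid β S n).filter (· = b i)) = fun i => {b i} := funext fun i => by
    ext z
    simpa using fun hz : z = b i => hz ▸ hb i
  rw [hcylinder, hfilter, Fintype.piFinset_singleton, Finset.sum_singleton]

theorem IsPathLaw.ae_mem_grid (hP : IsPathLaw β S n χ α t a P) (hτ : StrictMono τ) :
    ∀ᵐ ω ∂P, ∀ i, ω.1 (τ i) ∈ grid β S n := by
  have := hP.isProbabilityMeasure
  have hgrid : P.real {ω | ∀ i, ω.1 (τ i) ∈ (grid β S n : Set K)} =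
      P.real {ω | ∀ i, ω.1 (τ i) ∈ (Set.univ : Set K)} := by
    refine Complex.ofReal_injective ?_
    rw [hP.cylinder N τ hτ (fun _ => grid β S n) fun _ => (grid β S n).measurableSet,
      hP.cylinder N τ hτ (fun _ => Set.univ) fun _ => .univ]
    exact Finset.sum_congr (congrArg _ (funext fun _ => by ext z; simp)) fun _ _ => rfl
  simp only [Set.mem_univ, implies_true, Set.ofPred_true, probReal_univ] at hgrid
  exact (mem_ae_iff_prob_eq_one (measurableSet_cylinder τ fun _ =>
    (grid β S n).measurableSet)).2 ((ENNReal.toReal_eq_one_iff _).1 hgrid)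

theorem IsPathLaw.integral_eq_sum (hP : IsPathLaw β S n χ α t a P) (hτ : StrictMono τ)
    (G : (Fin N → K) → ℂ) :
    ∫ ω, G (fun i => ω.1 (τ i)) ∂P = ∑ b : Fin N → grid β S n,
      G (fun i => b i) * ((∏ i : Fin N, density β S n χ α
        ((τ i : ℝ) - (Fin.cons 0 (fun j => (τ j : ℝ)) : Fin (N + 1) → ℝ) i.castSucc)
        (b i - (Fin.cons a (fun i => (b i : K)) : Fin (N + 1) → K) i.castSucc)) *
      ((residueCard K : ℂ) ^ (n * N))⁻¹) := by
  have := hP.isProbabilityMeasure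
  let A (b : Fin N → grid β S n) : Set (skorokhod K t) := {ω | ∀ i, ω.1 (τ i) = b i}
  have hA (b) : MeasurableSet (A b) :=
    measurableSet_cylinder τ (J := fun i => {(b i : K)}) fun _ => measurableSet_singleton _
  have hG : (fun ω : skorokhod K t => G fun i => ω.1 (τ i)) =ᵐ[P] fun ω =>
      ∑ b : Fin N → grid β S n, (A b).indicator (fun _ => G fun i => b i) ω := by
    filter_upwards [hP.ae_mem_grid hτ] with ω hω
    rw [Fintype.sum_eq_single fun i => ⟨ω.1 (τ i), hω i⟩]
    · rw [Set.indicator_of_mem]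
      exact fun i => rfl
    · exact fun b hb => Set.indicator_of_notMem
        (fun h => hb (funext fun i => Subtype.ext (h i).symm)) _
  rw [integral_congr_ae hG,
    integral_finsetSum _ fun b _ => (integrable_const _).indicator (hA b)]
  refine Finset.sum_congr rfl fun b _ => ?_
  rw [integral_indicator (hA b), setIntegral_const, ← hP.real_eval_eq hτ fun i => (b i).2,
    mul_comm, Complex.real_smul]

end FiniteDimensional

theorem measurable_eval {X : Type*} [TopologicalSpace X] [MeasurableSpace X] {t : ℝ}
    (s : Set.Icc (0 : ℝ) t) : Measurable fun ω : skorokhod X t => ω.1 s :=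
  (measurable_pi_apply s).comp measurable_subtype_coe

section FeynmanKac

variable {K : Type*} [Field K] [ValuativeRel K] [TopologicalSpace K]
  [IsNonarchimedeanLocalField K] {β : K} {S : Finset K} {n : ℕ} {χ : AddChar K Circle}

/-- The Feynman–Kac weight `exp (-∫₀ᵗ v_n(ω s) ds)` of a path `ω`. -/
def pathWeight (β : K) (S : Finset K) (n : ℕ) (v : K → ℝ) {t : ℝ} (ω : skorokhod K t) : ℝ :=
  Real.exp (-∫ s : Set.Icc (0 : ℝ) t, discretize β S n v (ω.1 s) ∂(volume.comap Subtype.val))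

variable [MeasurableSpace K]

theorem bridgeMeasure_eq_cond (α : ℝ) {t : ℝ} (ht : 0 ≤ t) (a b : K) :
    bridgeMeasure β S n χ α t a b = ProbabilityTheory.cond (pathMeasure β S n χ α t a)
      {ω | ω.1 ⟨t, ht, le_rfl⟩ = b} := by
  rw [bridgeMeasure]
  congr 1
  ext ω
  exact ⟨fun h => h _ rfl, fun h s hs => (congrArg ω.1 (Subtype.ext hs)).trans h⟩

variable [BorelSpace K]

open Classical in
theorem setIntegral_exp_neg_sum_eq_pow (hβ : IsUniformizer β) (hS : IsResidueSystem S) {α t : ℝ}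
    (ht : 0 < t) (v : K → ℝ) {x : grid β S n} {P : Measure (skorokhod K t)}
    (hP : IsPathLaw β S n χ α t x P) {m : ℕ} (hm : 0 < m) (y : grid β S n) :
    ((∫ ω in {ω | ω.1 ⟨t, ht.le, le_rfl⟩ = y},
        Real.exp (-∑ i : Fin m, t / m * discretize β S n v (ω.1 (gridTime ht.le i))) ∂P : ℝ) : ℂ) =
      ((Matrix.of fun x y : grid β S n => ((residueCard K : ℂ) ^ n)⁻¹ *
        density β S n χ α (t / m) ((y : K) - x) * (Real.exp (-(t / m) * v y) : ℂ)) ^ m) x y := by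
  obtain ⟨k, rfl⟩ := Nat.exists_eq_add_one.2 hm
  let G (b : Fin (k + 1) → K) : ℂ := if b (Fin.last k) = y then
    (Real.exp (-∑ i, t / (k + 1 : ℕ) * discretize β S n v (b i)) : ℂ) else 0
  have hG : (fun ω : skorokhod K t => {ω | ω.1 ⟨t, ht.le, le_rfl⟩ = (y : K)}.indicator (fun ω =>
      (Real.exp (-∑ i : Fin (k + 1), t / (k + 1 : ℕ) *
        discretize β S n v (ω.1 (gridTime ht.le i))) : ℂ)) ω) =
      fun ω => G fun i => ω.1 (gridTime ht.le i) := by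
    ext ω
    simp only [Set.indicator_apply, Set.mem_ofPred_eq, G, gridTime_last]
  have hy : MeasurableSet {ω : skorokhod K t | ω.1 ⟨t, ht.le, le_rfl⟩ = (y : K)} :=
    measurable_eval _ (measurableSet_singleton (y : K))
  rw [← integral_complex_ofReal, ← integral_indicator hy, hG,
    hP.integral_eq_sum (strictMono_gridTime ht _) G, matrix_pow_apply_eq_sum_paths]
  refine Finset.sum_congr rfl fun b _ => ?_
  have hcons (j : Fin (k + 2)) : (Fin.cons (x : K) (fun i => (b i : K)) : Fin (k + 2) → K) j =
      ((Fin.cons x b : Fin (k + 2) → grid β S n) j : K) := by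
    refine Fin.cases ?_ (fun i => ?_) j <;> simp only [Fin.cons_zero, Fin.cons_succ]
  have hexponent : ∑ i : Fin (k + 1), -(t / (k + 1 : ℕ)) * v (b i) =
      -∑ i : Fin (k + 1), t / (k + 1 : ℕ) * discretize β S n v (b i) := by
    simp only [discretize_of_mem_grid hβ hS v (b _).2, neg_mul, Finset.sum_neg_distrib]
  simp only [gridTime_sub, hcons, Matrix.of_apply, Finset.prod_mul_distrib, Finset.prod_const,
    Finset.card_univ, Fintype.card_fin, ← Complex.ofReal_prod, ← Real.exp_sum, hexponent,
    ← Fin.succ_last, Fin.cons_succ, G, SetLike.coe_eq_coe, inv_pow, ← pow_mul, ite_mul, zero_mul]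
  congr 1
  ring

theorem tendsto_setIntegral_exp_neg_sum {t : ℝ} (ht : 0 < t) (v : K → ℝ)
    (P : Measure (skorokhod K t)) [IsFiniteMeasure P] (A : Set (skorokhod K t)) :
    Tendsto (fun m : ℕ => ∫ ω in A,
        Real.exp (-∑ i : Fin m, t / m * discretize β S n v (ω.1 (gridTime ht.le i))) ∂P) atTop
      (𝓝 (∫ ω in A, pathWeight β S n v ω ∂P)) := by
  set C := ∑ y ∈ grid β S n, ‖v y‖
  have hC : 0 ≤ C := Finset.sum_nonneg fun _ _ => norm_nonneg _
  refine tendsto_integral_of_dominated_convergence (fun _ => Real.exp (t * C)) (fun m => ?_)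
    (integrable_const _) (fun m => .of_forall fun ω => ?_) (.of_forall fun ω => ?_)
  · refine Measurable.aestronglyMeasurable (Real.measurable_exp.comp (Measurable.neg ?_))
    exact Finset.measurable_fun_sum _ fun i _ => measurable_const.mul
      ((continuous_discretize v).measurable.comp (measurable_eval _))
  · rw [Real.norm_eq_abs, Real.abs_exp, Real.exp_le_exp, ← Finset.sum_neg_distrib]
    calc ∑ i : Fin m, -(t / m * discretize β S n v (ω.1 (gridTime ht.le i)))
        ≤ ∑ _i : Fin m, t / m * C := by
          gcongr with i
          rw [← mul_neg]
          gcongr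
          exact (neg_le_abs _).trans (norm_discretize_le v _)
      _ = m * (t / m) * C := by
          rw [Finset.sum_const, Finset.card_univ, Fintype.card_fin, nsmul_eq_mul, mul_assoc]
      _ ≤ t * C := by
          refine mul_le_mul_of_nonneg_right ?_ hC
          rcases Nat.eq_zero_or_pos m with rfl | hm
          · simp [ht.le]
          · exact (mul_div_cancel₀ _ (by positivity)).le
  · exact (Real.continuous_exp.tendsto _).comp (tendsto_riemann_sum_path v ht ω).neg

theorem exp_hamiltonian_apply (hβ : IsUniformizer β) (hS : IsResidueSystem S)
    (hχ : HasRankZero β χ) {α : ℝ} (hα : 0 < α) {t : ℝ} (ht : 0 < t) (v : K → ℝ)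
    {x : grid β S n} {P : Measure (skorokhod K t)} (hP : IsPathLaw β S n χ α t x P)
    (f : GridL2 β S n) :
    NormedSpace.exp (-(t : ℂ) • hamiltonian β S n χ α v) f x =
      ∑ y : grid β S n, ((∫ ω in {ω | ω.1 ⟨t, ht.le, le_rfl⟩ = y},
        pathWeight β S n v ω ∂P : ℝ) : ℂ) * f y := by
  have := hP.isProbabilityMeasure
  have hpaths : Tendsto (fun m : ℕ => ∑ y : grid β S n,
      ((∫ ω in {ω | ω.1 ⟨t, ht.le, le_rfl⟩ = (y : K)}, Real.exp
        (-∑ i : Fin m, t / m * discretize β S n v (ω.1 (gridTime ht.le i))) ∂P : ℝ) : ℂ) * f y)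
      atTop (𝓝 (∑ y : grid β S n, ((∫ ω in {ω | ω.1 ⟨t, ht.le, le_rfl⟩ = (y : K)},
        pathWeight β S n v ω ∂P : ℝ) : ℂ) * f y)) :=
    tendsto_finsetSum _ fun y _ => ((Complex.continuous_ofReal.tendsto _).comp
      (tendsto_setIntegral_exp_neg_sum ht v P _)).mul_const _
  refine tendsto_nhds_unique (tendsto_transfer_pow_apply hβ hS hχ hα v t f x) (hpaths.congr' ?_)
  filter_upwards [eventually_gt_atTop 0] with m hm
  simp only [setIntegral_exp_neg_sum_eq_pow hβ hS ht v hP hm]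

theorem IsPathLaw.real_endpoint_eq {α t : ℝ} (ht : 0 ≤ t) {a b : K} {P : Measure (skorokhod K t)}
    (hP : IsPathLaw β S n χ α t a P) (hb : b ∈ grid β S n) :
    (P.real {ω | ω.1 ⟨t, ht, le_rfl⟩ = b} : ℂ) =
      density β S n χ α t (b - a) * ((residueCard K : ℂ) ^ n)⁻¹ := by
  simpa using hP.real_eval_eq (τ := fun _ : Fin 1 => ⟨t, ht, le_rfl⟩)
    (Subsingleton.strictMono _) (b := fun _ => b) fun _ => hb

theorem inv_mul_kernel (hβ : IsUniformizer β) (hS : IsResidueSystem S)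
    (hχ : HasRankZero β χ) {α : ℝ} (hα : 0 < α) {t : ℝ} (ht : 0 ≤ t) (v : K → ℝ)
    {x y : K} (hx : x ∈ grid β S n) (hy : y ∈ grid β S n) :
    ((residueCard K : ℂ) ^ n)⁻¹ * kernel β S n χ α t v x y =
      ((∫ ω in {ω | ω.1 ⟨t, ht, le_rfl⟩ = y}, pathWeight β S n v ω
        ∂(pathMeasure β S n χ α t x) : ℝ) : ℂ) := by
  have hP := isPathLaw_pathMeasure hβ hS hχ hα ht hx
  have := hP.isProbabilityMeasure
  set P := pathMeasure β S n χ α t x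
  set A := {ω : skorokhod K t | ω.1 ⟨t, ht, le_rfl⟩ = y}
  have hkernel : kernel β S n χ α t v x y =
      (((P.real A)⁻¹ * ∫ ω in A, pathWeight β S n v ω ∂P : ℝ) : ℂ) *
        density β S n χ α t (y - x) := by
    rw [kernel, bridgeMeasure_eq_cond α ht, ProbabilityTheory.cond, integral_smul_measure,
      ENNReal.toReal_inv]
    rfl
  have hdensity : (P.real A : ℂ) = density β S n χ α t (y - x) * ((residueCard K : ℂ) ^ n)⁻¹ :=
    hP.real_endpoint_eq ht hy
  rw [hkernel, mul_comm, mul_assoc, ← hdensity, ← Complex.ofReal_mul]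
  congr 1
  by_cases hA : P.real A = 0
  · rw [hA, mul_zero, setIntegral_measure_zero _ ((measureReal_eq_zero_iff (μ := P)).1 hA)]
  · field_simp

theorem exp_hamiltonian_eq_sum_kernel (hβ : IsUniformizer β) (hS : IsResidueSystem S)
    (hχ : HasRankZero β χ) {α : ℝ} (hα : 0 < α) {t : ℝ} (ht : 0 < t) (v : K → ℝ)
    (f : GridL2 β S n) (x : grid β S n) :
    NormedSpace.exp (-(t : ℂ) • hamiltonian β S n χ α v) f x =
      ((residueCard K : ℂ) ^ n)⁻¹ * ∑ y : grid β S n, kernel β S n χ α t v x y * f y := by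
  rw [exp_hamiltonian_apply hβ hS hχ hα ht v (isPathLaw_pathMeasure hβ hS hχ hα ht.le x.2) f,
    Finset.mul_sum]
  exact Finset.sum_congr rfl fun y _ => by
    rw [← mul_assoc, inv_mul_kernel hβ hS hχ hα ht.le v x.2 y.2]

theorem integral_gridMeasure (F : grid β S n → ℂ) :
    ∫ y, F y ∂(gridMeasure β S n) = ((residueCard K : ℂ) ^ n)⁻¹ * ∑ y, F y := by
  rw [gridMeasure, integral_smul_measure, integral_count]
  simp

end FeynmanKac

end FiniteFK

end

theorem mainTheorem3_general {K : Type*} [Field K] [ValuativeRel K] [TopologicalSpace K]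
    [IsNonarchimedeanLocalField K] [MeasurableSpace K] [BorelSpace K]
    {β : K} (hβ : FiniteFK.IsUniformizer β) {S : Finset K} (hS : FiniteFK.IsResidueSystem S)
    {χ : AddChar K Circle} (hχ : FiniteFK.HasRankZero β χ) (v : K → ℝ) {α : ℝ} (hα : 0 < α) (n : ℕ)
    {t : ℝ} (ht : 0 < t) :
    (∀ a ∈ FiniteFK.grid β S n, ∃! P : Measure (FiniteFK.skorokhod K t),
      FiniteFK.IsPathLaw β S n χ α t a P) ∧
    ∀ (f : FiniteFK.GridL2 β S n) (x : FiniteFK.grid β S n),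
      NormedSpace.exp (-(t : ℂ) • FiniteFK.hamiltonian β S n χ α v) f x =
          ∫ y, FiniteFK.kernel β S n χ α t v x y * f y ∂(FiniteFK.gridMeasure β S n) ∧
      NormedSpace.exp (-(t : ℂ) • FiniteFK.hamiltonian β S n χ α v) f x =
          ((FiniteFK.residueCard K : ℂ) ^ n)⁻¹ *
            ∑ y : FiniteFK.grid β S n, FiniteFK.kernel β S n χ α t v x y * f y := by
  refine ⟨fun a ha => FiniteFK.existsUnique_isPathLaw hβ hS hχ hα ht.le ha, fun f x => ?_⟩
  have hkernel := FiniteFK.exp_hamiltonian_eq_sum_kernel hβ hS hχ hα ht v f x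
  exact ⟨hkernel.trans (FiniteFK.integral_gridMeasure _).symm, hkernel⟩

theorem mainTheorem3 {K : Type*} [Field K] [ValuativeRel K] [TopologicalSpace K]
    [IsNonarchimedeanLocalField K] [MeasurableSpace K] [BorelSpace K]
    (β : K) (hβ : FiniteFK.IsUniformizer β)
    (S : Finset K) (hS : FiniteFK.IsResidueSystem S)
    (χ : AddChar K Circle) (hχc : Continuous χ) (hχ : FiniteFK.HasRankZero β χ)
    (v : K → ℝ) (hv0 : ∀ x, 0 ≤ v x) (hvc : Continuous v)
    (hv : Filter.Tendsto v (Filter.comap FiniteFK.canonicalAbs Filter.atTop) Filter.atTop)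
    (α : ℝ) (hα : 0 < α) (n : ℕ) (hn : 0 < n) (t : ℝ) (ht : 0 < t) :
    (∀ a ∈ FiniteFK.grid β S n, ∃! P : MeasureTheory.Measure (FiniteFK.skorokhod K t),
      FiniteFK.IsPathLaw β S n χ α t a P) ∧
    ∀ (f : FiniteFK.GridL2 β S n) (x : FiniteFK.grid β S n),
      (NormedSpace.exp (-(t : ℂ) • FiniteFK.hamiltonian β S n χ α v) f) x =
          ∫ y : FiniteFK.grid β S n, FiniteFK.kernel β S n χ α t v x y * f y
            ∂(FiniteFK.gridMeasure β S n) ∧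
      (NormedSpace.exp (-(t : ℂ) • FiniteFK.hamiltonian β S n χ α v) f) x =
          ((FiniteFK.residueCard K : ℂ) ^ n)⁻¹ *
            ∑ y : FiniteFK.grid β S n, FiniteFK.kernel β S n χ α t v x y * f y :=
  mainTheorem3_general hβ hS hχ v hα n ht
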